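/- Let $G=(V,E)$ be a maximal outerplanar graph with at least three vertices. Then $\mathrm{Fall}(G)=\{3\}$; that is, $G$ has a fall $3$-coloring, and it has no fall $k$-coloring for any $k\neq 3$. Here all graphs are finite, simple and undirected. A graph is outerplanar if it has a crossing-free drawing in the plane (vertices are distinct points, edges are simple arcs joining their ends and avoiding all other vertices, and two distinct edges meet only in common ends) in which every vertex lies on the boundary of the outer (unbounded) face. It is maximal outerplanar if it is outerplanar and is not properly contained in any outerplanar graph on the same vertex set. A fall $k$-coloring of $G$ is a partition of $V$ into exactly $k$ nonempty independent sets such that every vertex has a neighbor in each class other than its own, and $\mathrm{Fall}(G)$ is the set of all $k$ such that $G$ has a fall $k$-coloring. -/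

import Mathlib

/-- `S` is a (simple) arc in the plane with endpoints `x` and `y`: the image of a continuous
injective path from `x` to `y`. The Euclidean plane is `ℂ`. -/
def IsPlaneArc (S : Set ℂ) (x y : ℂ) : Prop :=
  ∃ γ : Path x y, Function.Injective γ ∧ Set.range γ = S

namespace SimpleGraph

/-- A drawing of `G` in the plane without crossings: distinct vertices are distinct points, every
edge is an arc joining its two ends and passing through no other vertex, and two distinct edges
meet only in common ends. The value of `arc` at a pair that is not an edge of `G` is irrelevant. -/
structure PlaneDrawing {V : Type*} (G : SimpleGraph V) where
  /-- the position of a vertex -/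
  pos : V → ℂ
  /-- the point set of an edge, including its ends -/
  arc : Sym2 V → Set ℂ
  pos_injective : Function.Injective pos
  isPlaneArc : ∀ u v : V, G.Adj u v → IsPlaneArc (arc s(u, v)) (pos u) (pos v)
  vertex_mem_arc : ∀ e ∈ G.edgeSet, ∀ v : V, pos v ∈ arc e → v ∈ e
  arc_inter : ∀ e ∈ G.edgeSet, ∀ f ∈ G.edgeSet, e ≠ f →
    ∀ z ∈ arc e ∩ arc f, ∃ v : V, v ∈ e ∧ v ∈ f ∧ pos v = z

/-- The set of all points of the plane that are covered by the drawing. -/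
def PlaneDrawing.support {V : Type*} {G : SimpleGraph V} (D : G.PlaneDrawing) : Set ℂ :=
  Set.range D.pos ∪ ⋃ e ∈ G.edgeSet, D.arc e

/-- The faces of a drawing are the connected components of its complement in the plane. -/
def PlaneDrawing.IsFace {V : Type*} {G : SimpleGraph V} (D : G.PlaneDrawing) (F : Set ℂ) : Prop :=
  ∃ x ∈ D.supportᶜ, F = connectedComponentIn D.supportᶜ x

/-- The outer face is the unbounded face. -/
def PlaneDrawing.IsOuterFace {V : Type*} {G : SimpleGraph V} (D : G.PlaneDrawing)
    (F : Set ℂ) : Prop :=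
  D.IsFace F ∧ ¬ Bornology.IsBounded F

/-- A graph is outerplanar if it has a crossing-free drawing in the plane such that every vertex
lies on the boundary of the outer face. -/
def IsOuterplanar {V : Type*} (G : SimpleGraph V) : Prop :=
  ∃ D : G.PlaneDrawing, ∃ F : Set ℂ, D.IsOuterFace F ∧ ∀ v : V, D.pos v ∈ frontier F

/-- An outerplanar graph is maximal outerplanar if no outerplanar graph on the same vertex set
properly contains it (the order on `SimpleGraph V` is inclusion of edge sets). -/
def IsMaximalOuterplanar {V : Type*} (G : SimpleGraph V) : Prop :=
  Maximal (fun H : SimpleGraph V => H.IsOuterplanar) G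

/-- A partition of the vertex set into (nonempty) independent sets is a fall coloring if every
vertex is colorful: it has a neighbor in each class other than its own. -/
def Partition.IsFall {V : Type*} {G : SimpleGraph V} (P : G.Partition) : Prop :=
  ∀ A ∈ P.parts, ∀ v ∈ A, ∀ B ∈ P.parts, B ≠ A → ∃ w ∈ B, G.Adj v w

/-- `G` has a fall `k`-coloring: a fall coloring with exactly `k` classes. -/
def HasFallColoring {V : Type*} (G : SimpleGraph V) (k : ℕ) : Prop :=
  ∃ P : G.Partition, P.parts.encard = k ∧ P.IsFall

/-- The fall set of `G`: all `k` such that `G` has a fall `k`-coloring. -/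
def fallSet {V : Type*} (G : SimpleGraph V) : Set ℕ :=
  {k | G.HasFallColoring k}

end SimpleGraph

/-!
A maximal outerplanar graph on at least three vertices is a triangulated polygon. In a triangulated
polygon every vertex lies in a triangle, and coloring one triangle after the other yields a proper
coloring with three colors; such a coloring is a fall coloring, as each vertex sees the two other
colors in its triangle. Conversely, some corner of the polygon is an ear: its only neighbors are
the two next to it, and the three form a triangle. In a fall coloring every class contains one of
these three vertices, and they are in different classes, so that there are exactly three classes.

The work lies in finding the polygon. An outerplanar graph contains no subdivision of `K₂,₃`
(`IsOuterplanar.thetaFree`) and no cycle with two crossing chords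
(`IsOuterplanar.crossingChordFree`). From these two properties alone one obtains an order of the
vertices in which no two edges cross (`exists_nonCrossing`): split the graph at cut vertices; if there
are none, a longest cycle is Hamiltonian, because an ear on it would have consecutive ends and give
a longer cycle, and its chords do not cross. Conversely, placing the vertices on a parabola in such
an order and drawing the edges as chords gives an outerplanar drawing
(`isOuterplanar_of_nonCrossing`). So a maximal outerplanar graph is a maximal noncrossing graph for
some order of its vertices, which is a triangulated polygon.

The two obstructions rest on the topology of curves in the plane, developed here with continuous
logarithms. For an arc `P` from `x` to `y`, the function `(z - x) / (z - y)` has a logarithm off `P`,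
and for two such arcs with only their ends in common the difference of the two logarithms is
locally constant off the Jordan curve `P ∪ Q`: it is the winding number. The curve leaves at most two
components (`IsPlaneArc.mem_connectedComponentIn_of_three`), and the winding number is not constant
near any inner point of the arcs (`IsPlaneArc.exists_sub_ne_near`). The three arcs of a theta curve
give three winding numbers, one of which is the sum of the two others. Counting the values near
inner points of the three arcs shows that no connected set off the curve accumulates at inner
points of all three (`IsTheta.false_of_mem_closure`), and also that the outer face of a drawing of
`K₄` cannot touch all four vertices (`false_of_mem_closure_of_crossing`).
-/

section Logarithms

open Set Topology unitInterval

/-! ### Continuous logarithms in the plane -/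

/-- `f` has a continuous logarithm on `s`. -/
def HasLogOn (f : ℂ → ℂ) (s : Set ℂ) : Prop :=
  ∃ g : ℂ → ℂ, ContinuousOn g s ∧ ∀ z ∈ s, Complex.exp (g z) = f z

/-- Continuous logarithms can be transported along homotopies of nonvanishing functions. -/
theorem exists_log_of_homotopy {X : Type*} [TopologicalSpace X] (H : I × X → ℂ)
    (hH : Continuous H) (hne : ∀ p, H p ≠ 0) (g₀ : X → ℂ) (hg₀ : Continuous g₀)
    (h₀ : ∀ x, Complex.exp (g₀ x) = H (0, x)) :
    ∃ g₁ : X → ℂ, Continuous g₁ ∧ ∀ x, Complex.exp (g₁ x) = H (1, x) := by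
  let H' : C(I × X, {z : ℂ // z ≠ 0}) := ⟨fun p => ⟨H p, hne p⟩, by fun_prop⟩
  have hlift := Complex.isCoveringMap_exp.liftHomotopy_lifts H' ⟨g₀, hg₀⟩
    (fun x => Subtype.ext (h₀ x).symm)
  refine ⟨fun x => Complex.isCoveringMap_exp.liftHomotopy H' ⟨g₀, hg₀⟩
    (fun x => Subtype.ext (h₀ x).symm) (1, x), by fun_prop, fun x => ?_⟩
  exact congrArg Subtype.val (congrFun hlift (1, x))

theorem HasLogOn.mono {f : ℂ → ℂ} {s t : Set ℂ} (h : HasLogOn f t) (hst : s ⊆ t) :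
    HasLogOn f s := by
  obtain ⟨g, hg, hgf⟩ := h
  exact ⟨g, hg.mono hst, fun z hz => hgf z (hst hz)⟩

theorem HasLogOn.congr {f f' : ℂ → ℂ} {s : Set ℂ} (h : HasLogOn f s)
    (hff : ∀ z ∈ s, f z = f' z) : HasLogOn f' s := by
  obtain ⟨g, hg, hgf⟩ := h
  exact ⟨g, hg, fun z hz => (hgf z hz).trans (hff z hz)⟩

theorem HasLogOn.mul {f f' : ℂ → ℂ} {s : Set ℂ} (h : HasLogOn f s) (h' : HasLogOn f' s) :
    HasLogOn (fun z => f z * f' z) s := by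
  obtain ⟨g, hg, hgf⟩ := h
  obtain ⟨g', hg', hgf'⟩ := h'
  exact ⟨fun z => g z + g' z, hg.add hg', fun z hz => by
    rw [Complex.exp_add, hgf z hz, hgf' z hz]⟩

/-- `(z - x) / (z - y)` has a logarithm off any path from `x` to `y`: deform the path. -/
theorem hasLogOn_compl_range_path {x y : ℂ} (γ : Path x y) :
    HasLogOn (fun z => (z - x) / (z - y)) (range γ)ᶜ := by
  have hne : ∀ (t : I) (z : ((range γ)ᶜ : Set ℂ)), (z : ℂ) - γ t ≠ 0 := fun t z h =>
    z.2 ⟨t, (sub_eq_zero.1 h).symm⟩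
  have hney : ∀ z : ((range γ)ᶜ : Set ℂ), (z : ℂ) - y ≠ 0 := fun z => by
    simpa using hne 1 z
  obtain ⟨g, hg, hgf⟩ := exists_log_of_homotopy
    (fun p : I × ((range γ)ᶜ : Set ℂ) => ((p.2 : ℂ) - γ (σ p.1)) / ((p.2 : ℂ) - y))
    (Continuous.div (by fun_prop) (by fun_prop) (fun p => hney p.2))
    (fun p => div_ne_zero (hne _ _) (hney _)) (fun _ => 0) continuous_const
    (fun z => by simp [div_self (hney z)])
  classical
  refine ⟨fun z => if h : z ∈ (range γ)ᶜ then g ⟨z, h⟩ else 0, ?_, fun z hz => ?_⟩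
  · rw [continuousOn_iff_continuous_domRestrict]
    refine hg.congr fun z => ?_
    simp only [domRestrict_apply, z.2, dite_true]
  · simp only [hz, dite_true, hgf]
    simp

/-- A nonvanishing continuous function on the plane has a continuous logarithm. -/
theorem hasLogOn_univ {f : ℂ → ℂ} (hf : Continuous f) (hne : ∀ z, f z ≠ 0) :
    HasLogOn f univ := by
  obtain ⟨g, hg, hgf⟩ := exists_log_of_homotopy (fun p : I × ℂ => f ((p.1 : ℂ) * p.2))
    (by fun_prop) (fun p => hne _) (fun _ => Complex.log (f 0)) continuous_const
    (fun z => by simp [Complex.exp_log (hne 0)])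
  exact ⟨g, hg.continuousOn, fun z _ => by simp [hgf]⟩

/-- A continuous function with values in `2πiℤ` is constant on preconnected sets. -/
theorem IsPreconnected.eq_of_exp_eq_one {X : Type*} [TopologicalSpace X] {S : Set X}
    (hS : IsPreconnected S) {d : X → ℂ} (hd : ContinuousOn d S)
    (hexp : ∀ x ∈ S, Complex.exp (d x) = 1) {x y : X} (hx : x ∈ S) (hy : y ∈ S) : d x = d y :=
  Complex.isCoveringMap_exp.eqOn_of_comp_eqOn hS hd (continuousOn_const (c := d y))
    (fun z hz => Subtype.ext ((hexp z hz).trans (hexp y hy).symm)) hy rfl hx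

/-- A power of `z - a` with nonzero exponent has no logarithm on a circle about `a`. -/
theorem not_hasLogOn_sphere {a : ℂ} {r : ℝ} (hr : 0 < r) {m : ℤ} (hm : m ≠ 0) :
    ¬ HasLogOn (fun z => (z - a) ^ m) (Metric.sphere a r) := by
  rintro ⟨g, hg, hgf⟩
  have hmem : ∀ t : ℝ, a + r * Complex.exp (t * Complex.I) ∈ Metric.sphere a r := fun t => by
    simp [Complex.norm_exp_ofReal_mul_I, abs_of_pos hr]
  -- `d` compares the logarithm with the evident one; it is continuous with values in `2πiℤ`
  let d : ℝ → ℂ := fun t => g (a + r * Complex.exp (t * Complex.I)) -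
    m * (Real.log r + t * Complex.I)
  have hd : Continuous d := by
    refine Continuous.sub (hg.comp_continuous (by fun_prop) hmem) (by fun_prop)
  have hexp : ∀ t, Complex.exp (d t) = 1 := fun t => by
    have hr' : (r : ℂ) ≠ 0 := by exact_mod_cast hr.ne'
    have h1 : Complex.exp (m * (Real.log r + t * Complex.I)) =
        (r * Complex.exp (t * Complex.I)) ^ m := by
      rw [Complex.exp_int_mul, Complex.exp_add, ← Complex.ofReal_exp, Real.exp_log hr]
    simp only [d]
    rw [Complex.exp_sub, hgf _ (hmem t), h1]
    simp only [add_sub_cancel_left]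
    exact div_self (zpow_ne_zero _ (mul_ne_zero hr' (Complex.exp_ne_zero _)))
  have h := isPreconnected_univ.eq_of_exp_eq_one hd.continuousOn (fun t _ => hexp t)
    (mem_univ (0 : ℝ)) (mem_univ (2 * Real.pi))
  have h2 : (m : ℂ) * (2 * Real.pi * Complex.I) = 0 := by
    simp only [d] at h
    push_cast at h
    rw [Complex.exp_two_pi_mul_I] at h
    simp only [zero_mul, Complex.exp_zero] at h
    linear_combination h
  have hpi : (2 * Real.pi * Complex.I : ℂ) ≠ 0 := Complex.two_pi_I_ne_zero
  exact hm (by exact_mod_cast (mul_eq_zero.1 h2).resolve_right hpi)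

theorem not_hasLogOn_compl_pair {x y : ℂ} (hxy : x ≠ y) :
    ¬ HasLogOn (fun z => (z - x) / (z - y)) {x, y}ᶜ := by
  intro h
  have hpos : 0 < dist x y := dist_pos.2 hxy
  have hnear : ∀ z ∈ Metric.sphere x (dist x y / 2), (z - y) / (x - y) ∈ Complex.slitPlane := by
    intro z hz
    rw [mem_sphere_iff_norm] at hz
    have hxy' : x - y ≠ 0 := sub_ne_zero.2 hxy
    have : (z - y) / (x - y) = 1 + (z - x) / (x - y) := by field_simp; ring
    rw [this]
    refine Complex.mem_slitPlane_of_norm_lt_one ?_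
    rw [norm_div, hz, div_lt_one (norm_pos_iff.2 hxy'), dist_eq_norm]
    rw [dist_eq_norm] at hpos
    linarith
  have hlog : HasLogOn (fun z => z - y) (Metric.sphere x (dist x y / 2)) := by
    refine ⟨fun z => Complex.log ((z - y) / (x - y)) + Complex.log (x - y), ?_, fun z hz => ?_⟩
    · exact ContinuousOn.add (ContinuousOn.clog (by fun_prop) hnear) continuousOn_const
    · have hxy' : x - y ≠ 0 := sub_ne_zero.2 hxy
      rw [Complex.exp_add, Complex.exp_log (Complex.slitPlane_ne_zero (hnear z hz)),
        Complex.exp_log hxy', div_mul_cancel₀ _ hxy']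
  have hsub : Metric.sphere x (dist x y / 2) ⊆ {x, y}ᶜ := by
    rintro z hz (rfl | rfl)
    · simp only [Metric.mem_sphere, dist_self] at hz; linarith
    · rw [Metric.mem_sphere, dist_comm] at hz; linarith
  refine not_hasLogOn_sphere (a := x) (half_pos hpos) one_ne_zero
    (((h.mono hsub).mul hlog).congr fun z hz => ?_)
  have : z - y ≠ 0 := fun h0 => hsub hz (by simp [sub_eq_zero.1 h0])
  simp [div_mul_cancel₀ _ this]

theorem frontier_connectedComponentIn_compl_subset {K : Set ℂ} (hK : IsClosed K) (a : ℂ) :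
    frontier (connectedComponentIn Kᶜ a) ⊆ K := by
  intro w hw
  by_contra hwK
  have hD : IsOpen (connectedComponentIn Kᶜ a) := hK.isOpen_compl.connectedComponentIn
  have hW : IsOpen (connectedComponentIn Kᶜ w) := hK.isOpen_compl.connectedComponentIn
  obtain ⟨u, hu, hu'⟩ := mem_closure_iff.1 hw.1 _ hW (mem_connectedComponentIn hwK)
  have h1 := connectedComponentIn_eq hu
  have h2 := connectedComponentIn_eq hu'
  rw [hD.frontier_eq] at hw
  exact hw.2 (h2 ▸ h1 ▸ mem_connectedComponentIn hwK)

/-- If `D` is the bounded component of the complement of `K` around `a`, then the exponent of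
`z - a` in a function with a logarithm on `K` vanishes: otherwise, extending the logarithm over
`D`, one would find a nonvanishing function on the plane that agrees with that power of `z - a`
outside `D`. -/
theorem eq_zero_of_hasLogOn {K : Set ℂ} (hK : IsCompact K) {a : ℂ}
    (hb : Bornology.IsBounded (connectedComponentIn Kᶜ a)) (ha : a ∉ K) {m : ℤ} {q : ℂ → ℂ}
    (hq : ContinuousOn q (K ∪ connectedComponentIn Kᶜ a))
    (hq0 : ∀ z ∈ K ∪ connectedComponentIn Kᶜ a, q z ≠ 0)
    (h : HasLogOn (fun z => (z - a) ^ m * q z) K) : m = 0 := by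
  classical
  by_contra hm
  obtain ⟨g, hg, hgf⟩ := h
  obtain ⟨G, hG⟩ := ContinuousMap.exists_restrict_eq hK.isClosed
    ⟨K.domRestrict g, continuousOn_iff_continuous_domRestrict.1 hg⟩
  have hGg : ∀ z ∈ K, G z = g z := fun z hz => DFunLike.congr_fun hG ⟨z, hz⟩
  set D := connectedComponentIn Kᶜ a with hDdef
  have hD : IsOpen D := hK.isClosed.isOpen_compl.connectedComponentIn
  have hfr : frontier D ⊆ K := frontier_connectedComponentIn_compl_subset hK.isClosed a
  have hcl : closure D ⊆ K ∪ D := by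
    rw [closure_eq_self_union_frontier]
    exact union_subset subset_union_right (hfr.trans subset_union_left)
  have haD : a ∈ D := mem_connectedComponentIn ha
  have hcont : Continuous
      (D.piecewise (fun z => Complex.exp (G z) / q z) (fun z => (z - a) ^ m)) := by
    refine continuous_piecewise (fun z hz => ?_) ?_ ?_
    · have hz' := hfr hz
      rw [hGg z hz', hgf z hz', mul_div_assoc, div_self (hq0 z (Or.inl hz')), mul_one]
    · exact ContinuousOn.div (by fun_prop) (hq.mono hcl) fun z hz => hq0 z (hcl hz)
    · rw [hD.isClosed_compl.closure_eq]
      refine ContinuousOn.zpow₀ (by fun_prop) m fun z hz => Or.inl ?_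
      exact sub_ne_zero.2 fun h => hz (h ▸ haD)
  have hne : ∀ z, D.piecewise (fun z => Complex.exp (G z) / q z) (fun z => (z - a) ^ m) z ≠ 0 := by
    intro z
    by_cases hz : z ∈ D
    · rw [piecewise_eq_of_mem _ _ _ hz]
      exact div_ne_zero (Complex.exp_ne_zero _) (hq0 z (Or.inr hz))
    · rw [piecewise_eq_of_notMem _ _ _ hz]
      exact zpow_ne_zero _ (sub_ne_zero.2 fun h => hz (h ▸ haD))
  obtain ⟨r, hr, hDr⟩ := hb.subset_ball_lt 0 a
  refine not_hasLogOn_sphere hr hm (((hasLogOn_univ hcont hne).mono (subset_univ _)).congr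
    fun z hz => piecewise_eq_of_notMem _ _ _ fun hzD => ?_)
  have := hDr hzD
  rw [Metric.mem_ball] at this
  exact this.ne hz

/-- Of two different components of the complement of a compact set, one is bounded. -/
theorem isBounded_connectedComponentIn_compl {K : Set ℂ} (hK : IsCompact K) {a b : ℂ}
    (hab : b ∉ connectedComponentIn Kᶜ a) (hb : b ∉ K) :
    Bornology.IsBounded (connectedComponentIn Kᶜ a) ∨
      Bornology.IsBounded (connectedComponentIn Kᶜ b) := by
  by_contra! hcon
  obtain ⟨r, hr, hKr⟩ := hK.isBounded.subset_ball_lt 0 0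
  have hconn : IsPreconnected (Metric.ball (0 : ℂ) r)ᶜ := by
    have himg : (Metric.ball (0 : ℂ) r)ᶜ =
        (fun p : ℝ × ℝ => (p.1 : ℂ) * Complex.exp (p.2 * Complex.I)) '' (Ici r ×ˢ univ) := by
      ext z
      constructor
      · intro hz
        exact ⟨(‖z‖, Complex.arg z), ⟨by simpa using hz, mem_univ _⟩,
          Complex.norm_mul_exp_arg_mul_I z⟩
      · rintro ⟨⟨s, t⟩, ⟨hs, -⟩, rfl⟩
        have hs' : r ≤ s := hs
        simpa [Complex.norm_exp_ofReal_mul_I] using hs'.trans (le_abs_self s)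
    rw [himg]
    exact (isPreconnected_Ici.prod isPreconnected_univ).image _ (by fun_prop)
  have hsub : (Metric.ball (0 : ℂ) r)ᶜ ⊆ Kᶜ := compl_subset_compl.2 hKr
  have key : ∀ c, ¬ Bornology.IsBounded (connectedComponentIn Kᶜ c) →
      (Metric.ball (0 : ℂ) r)ᶜ ⊆ connectedComponentIn Kᶜ c := by
    intro c hc
    have : ∃ z ∈ connectedComponentIn Kᶜ c, z ∉ Metric.ball (0 : ℂ) r := by
      by_contra! h
      exact hc (Metric.isBounded_ball.subset h)
    obtain ⟨z, hz, hzr⟩ := this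
    rw [connectedComponentIn_eq hz]
    exact hconn.subset_connectedComponentIn hzr hsub
  have hr' : (r : ℂ) ∈ (Metric.ball (0 : ℂ) r)ᶜ := by simp [abs_of_pos hr]
  have h1 := connectedComponentIn_eq (key a hcon.1 hr')
  have h2 := connectedComponentIn_eq (key b hcon.2 hr')
  exact hab (h1 ▸ h2 ▸ mem_connectedComponentIn hb)

end Logarithms

section Arcs

open Set Topology unitInterval

/-! ### Separation of the plane by compact sets and arcs -/

/-- Every nonvanishing continuous function on `K` has a continuous logarithm. -/
def LogAcyclic (K : Set ℂ) : Prop :=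
  ∀ f : ℂ → ℂ, ContinuousOn f K → (∀ z ∈ K, f z ≠ 0) → HasLogOn f K

/-- Logarithms on two closed sets glue if they differ by a constant on the intersection. -/
theorem hasLogOn_union {f : ℂ → ℂ} {A B : Set ℂ} (hA : IsClosed A) (hB : IsClosed B)
    {g₁ g₂ : ℂ → ℂ} (h₁ : ContinuousOn g₁ A) (h₂ : ContinuousOn g₂ B)
    (e₁ : ∀ z ∈ A, Complex.exp (g₁ z) = f z) (e₂ : ∀ z ∈ B, Complex.exp (g₂ z) = f z)
    {c : ℂ} (hc : Complex.exp c = 1) (h : ∀ z ∈ A, z ∈ B → g₁ z = g₂ z + c) :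
    HasLogOn f (A ∪ B) := by
  classical
  have hgA : ∀ z ∈ A, (if z ∈ A then g₁ z else g₂ z + c) = g₁ z := fun z hz => by simp [hz]
  have hgB : ∀ z ∈ B, (if z ∈ A then g₁ z else g₂ z + c) = g₂ z + c := fun z hz => by
    by_cases hzA : z ∈ A
    · simp [hzA, h z hzA hz]
    · simp [hzA]
  refine ⟨fun z => if z ∈ A then g₁ z else g₂ z + c, ?_, ?_⟩
  · exact ContinuousOn.union_of_isClosed (h₁.congr hgA)
      ((h₂.add continuousOn_const).congr hgB) hA hB
  · rintro z (hz | hz)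
    · simp only [hgA z hz, e₁ z hz]
    · simp only [hgB z hz, Complex.exp_add, e₂ z hz, hc, mul_one]

theorem LogAcyclic.union {A B : Set ℂ} (hA : LogAcyclic A) (hB : LogAcyclic B)
    (cA : IsClosed A) (cB : IsClosed B) {p : ℂ} (hp : A ∩ B = {p}) : LogAcyclic (A ∪ B) := by
  intro f hf hne
  obtain ⟨g₁, h₁, e₁⟩ := hA f (hf.mono subset_union_left) fun z hz => hne z (Or.inl hz)
  obtain ⟨g₂, h₂, e₂⟩ := hB f (hf.mono subset_union_right) fun z hz => hne z (Or.inr hz)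
  have hpAB : p ∈ A ∩ B := hp ▸ mem_singleton p
  refine hasLogOn_union cA cB h₁ h₂ e₁ e₂ (c := g₁ p - g₂ p) ?_ ?_
  · rw [Complex.exp_sub, e₁ p hpAB.1, e₂ p hpAB.2, div_self (hne p (Or.inl hpAB.1))]
  · intro z hz hz'
    obtain rfl : z = p := hp.subset ⟨hz, hz'⟩
    ring

/-- Contract a piece of an arc along the arc to one of its points. -/
theorem logAcyclic_image_Icc {x y : ℂ} (γ : Path x y) (hγ : Function.Injective γ) (s t : I) :
    LogAcyclic (γ '' Icc s t) := by
  intro f hf hne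
  rcases (Icc s t).eq_empty_or_nonempty with he | ⟨w, hw⟩
  · rw [he, image_empty]; exact ⟨0, continuousOn_empty _, fun z hz => hz.elim⟩
  have hst : s ≤ t := hw.1.trans hw.2
  have hemb : IsClosedEmbedding γ := γ.continuous.isClosedEmbedding hγ
  let e := hemb.toHomeomorph
  have hsub : ∀ z : γ '' Icc s t, (z : ℂ) ∈ range γ := fun z => image_subset_range _ _ z.2
  let φ : γ '' Icc s t → I := fun z => e.symm ⟨z, hsub z⟩
  have hφ : Continuous φ := by fun_prop
  have hγφ : ∀ z, γ (φ z) = z := fun z =>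
    congrArg Subtype.val (e.apply_symm_apply ⟨z, hsub z⟩)
  have hφI : ∀ z, φ z ∈ Icc s t := fun z => by
    obtain ⟨u, hu, huz⟩ := z.2
    have : φ z = u := hγ ((hγφ z).trans huz.symm)
    rwa [this]
  have hmem : ∀ p : I × (γ '' Icc s t),
      γ.extend (s + p.1 * ((φ p.2 : ℝ) - s)) ∈ γ '' Icc s t := by
    rintro ⟨τ, z⟩
    have h1 : (s : ℝ) ≤ φ z := (hφI z).1
    have h2 : (φ z : ℝ) ≤ t := (hφI z).2
    have h3 : (s : ℝ) ≤ s + τ * ((φ z : ℝ) - s) := by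
      have := mul_nonneg τ.2.1 (sub_nonneg.2 h1); linarith
    have h4 : s + τ * ((φ z : ℝ) - s) ≤ (t : ℝ) := by
      have := mul_le_mul_of_nonneg_right τ.2.2 (sub_nonneg.2 h1); linarith
    have h5 : (s : ℝ) + τ * ((φ z : ℝ) - s) ∈ I := ⟨s.2.1.trans h3, h4.trans t.2.2⟩
    exact ⟨⟨_, h5⟩, ⟨h3, h4⟩, (γ.extend_apply h5).symm⟩
  have hf' : Continuous fun p : I × (γ '' Icc s t) => f (γ.extend (s + p.1 * ((φ p.2 : ℝ) - s))) :=
    hf.comp_continuous (by fun_prop) hmem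
  obtain ⟨g, hg, hgf⟩ := exists_log_of_homotopy _ hf' (fun p => hne _ (hmem p))
    (fun _ => Complex.log (f (γ s))) continuous_const (fun z => by
      have : f (γ s) ≠ 0 := hne _ ⟨s, ⟨le_rfl, hst⟩, rfl⟩
      simp [Complex.exp_log this])
  classical
  refine ⟨fun z => if h : z ∈ γ '' Icc s t then g ⟨z, h⟩ else 0, ?_, fun z hz => ?_⟩
  · rw [continuousOn_iff_continuous_domRestrict]
    refine hg.congr fun z => ?_
    rw [domRestrict_apply, dif_pos z.2]
  · have h1 := hgf ⟨z, hz⟩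
    have h2 := hγφ ⟨z, hz⟩
    simp only [dif_pos hz, h1]
    simp [h2]

theorem mem_connectedComponentIn_symm {X : Type*} [TopologicalSpace X] {F : Set X} {a b : X}
    (h : b ∈ connectedComponentIn F a) (ha : a ∈ F) : a ∈ connectedComponentIn F b := by
  rw [← connectedComponentIn_eq h]
  exact mem_connectedComponentIn ha

/-- A compact set on which every nonvanishing function has a logarithm does not separate the
plane. -/
theorem LogAcyclic.isPreconnected_compl {K : Set ℂ} (hK : LogAcyclic K) (cK : IsCompact K) :
    IsPreconnected Kᶜ := by
  have key : ∀ a b, a ∉ K → b ∉ K → b ∉ connectedComponentIn Kᶜ a →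
      ¬ Bornology.IsBounded (connectedComponentIn Kᶜ a) := by
    intro a b ha hb hab hbd
    have hsub : ∀ z ∈ K ∪ connectedComponentIn Kᶜ a, z - b ≠ 0 := by
      rintro z hz h0
      obtain rfl := sub_eq_zero.1 h0
      exact hz.elim hb hab
    refine one_ne_zero (eq_zero_of_hasLogOn cK hbd ha (m := 1) (q := fun z => (z - b)⁻¹)
      (ContinuousOn.inv₀ (by fun_prop) hsub) (fun z hz => inv_ne_zero (hsub z hz)) (hK _ ?_ ?_))
    · exact ContinuousOn.mul (by simp only [zpow_one]; fun_prop)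
        (ContinuousOn.inv₀ (by fun_prop) fun z hz => hsub z (Or.inl hz))
    · intro z hz
      refine mul_ne_zero (zpow_ne_zero _ (sub_ne_zero.2 ?_)) (inv_ne_zero (hsub z (Or.inl hz)))
      rintro rfl
      exact ha hz
  rcases Kᶜ.eq_empty_or_nonempty with he | ⟨a, ha⟩
  · rw [he]; exact isPreconnected_empty
  refine isPreconnected_of_forall a fun b hb => ⟨connectedComponentIn Kᶜ a,
    connectedComponentIn_subset _ _, mem_connectedComponentIn ha, ?_,
    isPreconnected_connectedComponentIn⟩
  by_contra hab
  rcases isBounded_connectedComponentIn_compl cK hab hb with h | h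
  · exact key a b ha hb hab h
  · exact key b a hb ha (fun h' => hab (mem_connectedComponentIn_symm h' hb)) h

/-- If `a`, `b`, `c` lie in three different components of the complement of `K`, then the functions
`z - a`, `z - b`, `z - c` satisfy no multiplicative relation of degree zero up to functions with
a logarithm on `K`. -/
theorem exponents_eq_zero_of_hasLogOn {K : Set ℂ} (hK : IsCompact K) {a b c : ℂ} (ha : a ∉ K)
    (hb : b ∉ K) (hc : c ∉ K) (hab : b ∉ connectedComponentIn Kᶜ a)
    (hac : c ∉ connectedComponentIn Kᶜ a) (hbc : c ∉ connectedComponentIn Kᶜ b) {i j k : ℤ}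
    (hijk : i + j + k = 0)
    (h : HasLogOn (fun z => (z - a) ^ i * ((z - b) ^ j * (z - c) ^ k)) K) :
    i = 0 ∧ j = 0 := by
  have key : ∀ (a b c : ℂ) (i j k : ℤ), a ∉ K → b ∉ K → c ∉ K →
      b ∉ connectedComponentIn Kᶜ a → c ∉ connectedComponentIn Kᶜ a →
      HasLogOn (fun z => (z - a) ^ i * ((z - b) ^ j * (z - c) ^ k)) K →
      Bornology.IsBounded (connectedComponentIn Kᶜ a) → i = 0 := by
    intro a b c i j k ha hb hc hab hac h hbd
    have hsub : ∀ w, w ∉ K → w ∉ connectedComponentIn Kᶜ a →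
        ∀ z ∈ K ∪ connectedComponentIn Kᶜ a, z - w ≠ 0 := by
      intro w hw hw' z hz h0
      obtain rfl := sub_eq_zero.1 h0
      exact hz.elim hw hw'
    refine eq_zero_of_hasLogOn hK hbd ha ?_ (fun z hz => ?_) h
    · refine ContinuousOn.mul ?_ ?_
      · exact ContinuousOn.zpow₀ (by fun_prop) j fun z hz => Or.inl (hsub b hb hab z hz)
      · exact ContinuousOn.zpow₀ (by fun_prop) k fun z hz => Or.inl (hsub c hc hac z hz)
    · exact mul_ne_zero (zpow_ne_zero _ (hsub b hb hab z hz)) (zpow_ne_zero _ (hsub c hc hac z hz))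
  have hba := fun h' => hab (mem_connectedComponentIn_symm h' hb)
  have hca := fun h' => hac (mem_connectedComponentIn_symm h' hc)
  have hcb := fun h' => hbc (mem_connectedComponentIn_symm h' hc)
  have ka := key a b c i j k ha hb hc hab hac h
  have kb := key b a c j i k hb ha hc hba hbc (h.congr fun z _ => by ring)
  have kc := key c a b k i j hc ha hb hca hcb (h.congr fun z _ => by ring)
  rcases isBounded_connectedComponentIn_compl hK hab hb with h1 | h1 <;>
  rcases isBounded_connectedComponentIn_compl hK hac hc with h2 | h2 <;>
  rcases isBounded_connectedComponentIn_compl hK hbc hc with h3 | h3 <;>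
  grind

theorem IsPlaneArc.isCompact {S : Set ℂ} {x y : ℂ} (h : IsPlaneArc S x y) : IsCompact S := by
  obtain ⟨γ, -, rfl⟩ := h
  exact isCompact_range γ.continuous

theorem IsPlaneArc.left_mem {S : Set ℂ} {x y : ℂ} (h : IsPlaneArc S x y) : x ∈ S := by
  obtain ⟨γ, -, rfl⟩ := h
  exact ⟨0, γ.source⟩

theorem IsPlaneArc.right_mem {S : Set ℂ} {x y : ℂ} (h : IsPlaneArc S x y) : y ∈ S := by
  obtain ⟨γ, -, rfl⟩ := h
  exact ⟨1, γ.target⟩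

theorem IsPlaneArc.ne {S : Set ℂ} {x y : ℂ} (h : IsPlaneArc S x y) : x ≠ y := by
  obtain ⟨γ, hγ, rfl⟩ := h
  intro hxy
  exact zero_ne_one (hγ (γ.source.trans (hxy.trans γ.target.symm)) : (0 : I) = 1)

theorem IsPlaneArc.symm {S : Set ℂ} {x y : ℂ} (h : IsPlaneArc S x y) : IsPlaneArc S y x := by
  obtain ⟨γ, hγ, rfl⟩ := h
  exact ⟨γ.symm, hγ.comp unitInterval.symm_bijective.injective, γ.symm_range⟩

theorem IsPlaneArc.logAcyclic {S : Set ℂ} {x y : ℂ} (h : IsPlaneArc S x y) : LogAcyclic S := by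
  obtain ⟨γ, hγ, rfl⟩ := h
  have := logAcyclic_image_Icc γ hγ 0 1
  rwa [show Icc (0 : I) 1 = univ from Icc_bot_top, image_univ] at this

/-- An arc without its ends is connected, and each of the ends is in its closure. -/
theorem IsPlaneArc.isPreconnected_diff {S : Set ℂ} {x y : ℂ} (h : IsPlaneArc S x y) :
    ∃ T : Set ℂ, IsPreconnected T ∧ T.Nonempty ∧ T ⊆ S ∧ x ∉ T ∧ y ∉ T ∧ x ∈ closure T ∧
      y ∈ closure T := by
  obtain ⟨γ, hγ, rfl⟩ := h
  have hhalf : (⟨1 / 2, by norm_num, by norm_num⟩ : I) ∈ Ioo (0 : I) 1 := by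
    constructor <;> (rw [← Subtype.coe_lt_coe]; norm_num)
  have hcl : closure (Ioo (0 : I) 1) = Icc 0 1 := closure_Ioo zero_ne_one
  have himg : γ '' Icc 0 1 ⊆ closure (γ '' Ioo 0 1) :=
    hcl ▸ image_closure_subset_closure_image γ.continuous
  refine ⟨γ '' Ioo 0 1, isPreconnected_Ioo.image _ γ.continuous.continuousOn,
    ⟨_, mem_image_of_mem _ hhalf⟩, image_subset_range _ _, ?_, ?_, ?_, ?_⟩
  · rintro ⟨t, ht, htx⟩
    exact ht.1.ne' (hγ (htx.trans γ.source.symm))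
  · rintro ⟨t, ht, htx⟩
    exact ht.2.ne (hγ (htx.trans γ.target.symm))
  · exact himg ⟨0, ⟨le_rfl, zero_le_one⟩, γ.source⟩
  · exact himg ⟨1, ⟨zero_le_one, le_rfl⟩, γ.target⟩

end Arcs

section JordanCurves

open Set Topology unitInterval

/-! ### Jordan curves composed of two arcs -/

/-- `g` is a continuous logarithm of `(z - x) / (z - y)` off the set `P`. For arcs `P`, `Q` from `x`
to `y` that meet only in their ends, the difference of two such logarithms is, up to a constant
and the factor `2πi`, the winding number of the Jordan curve `P ∪ Q`. -/
structure IsArcLog (g : ℂ → ℂ) (P : Set ℂ) (x y : ℂ) : Prop where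
  continuousOn : ContinuousOn g Pᶜ
  exp_eq : ∀ z ∈ Pᶜ, Complex.exp (g z) = (z - x) / (z - y)

theorem IsPlaneArc.exists_isArcLog {P : Set ℂ} {x y : ℂ} (h : IsPlaneArc P x y) :
    ∃ g, IsArcLog g P x y := by
  obtain ⟨γ, -, rfl⟩ := h
  obtain ⟨g, hg, hgf⟩ := hasLogOn_compl_range_path γ
  exact ⟨g, hg, hgf⟩

variable {P Q : Set ℂ} {x y : ℂ} {g g' : ℂ → ℂ}

theorem IsArcLog.exp_sub (hg : IsArcLog g P x y) (hg' : IsArcLog g' Q x y)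
    (hP : IsPlaneArc P x y) {z : ℂ} (hz : z ∉ P) (hz' : z ∉ Q) :
    Complex.exp (g z - g' z) = 1 := by
  rw [Complex.exp_sub, hg.exp_eq z hz, hg'.exp_eq z hz']
  refine div_self (div_ne_zero (sub_ne_zero.2 ?_) (sub_ne_zero.2 ?_))
  · rintro rfl; exact hz hP.left_mem
  · rintro rfl; exact hz hP.right_mem

theorem IsArcLog.sub_eq (hg : IsArcLog g P x y) (hg' : IsArcLog g' Q x y)
    (hP : IsPlaneArc P x y) {S : Set ℂ} (hS : IsPreconnected S) (hSPQ : S ⊆ (P ∪ Q)ᶜ)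
    {a b : ℂ} (ha : a ∈ S) (hb : b ∈ S) : g a - g' a = g b - g' b := by
  rw [compl_union, subset_inter_iff] at hSPQ
  exact hS.eq_of_exp_eq_one (d := fun z => g z - g' z)
    ((hg.continuousOn.mono hSPQ.1).sub (hg'.continuousOn.mono hSPQ.2))
    (fun _ hz => hg.exp_sub hg' hP (hSPQ.1 hz) (hSPQ.2 hz)) ha hb

/-- Each inner point of `P` is adjacent to points of the complement of `P ∪ Q` with different
winding numbers: otherwise the winding number would be locally constant on the complement of a
smaller arc, which is connected, so the logarithms off `P` and off `Q` would glue to a logarithm of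
`(z - x) / (z - y)` on the twice punctured plane. -/
theorem IsPlaneArc.exists_sub_ne_near (hP : IsPlaneArc P x y) (hQ : IsPlaneArc Q x y)
    (hPQ : ∀ z ∈ P, z ∈ Q → z = x ∨ z = y) (hg : IsArcLog g P x y) (hg' : IsArcLog g' Q x y)
    {p : ℂ} (hp : p ∈ P) (hpx : p ≠ x) (hpy : p ≠ y) {N : Set ℂ} (hN : N ∈ 𝓝 p) {c : ℂ}
    (hc : Complex.exp c = 1) : ∃ z ∈ N, z ∉ P ∧ z ∉ Q ∧ g z - g' z ≠ c := by
  classical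
  by_contra! hcon
  have hxy := hP.ne
  have cP := hP.isCompact.isClosed
  have cQ := hQ.isCompact.isClosed
  have hQx := hQ.left_mem
  have hQy := hQ.right_mem
  have hexp : ∀ z, z ∉ P → z ∉ Q → Complex.exp (g z - g' z) = 1 := fun z hz hz' =>
    hg.exp_sub hg' hP hz hz'
  obtain ⟨γ, hγ, rfl⟩ := hP
  obtain ⟨t, rfl⟩ := hp
  have ht0 : 0 < t := lt_of_le_of_ne t.2.1 fun h => hpx (by rw [← h]; exact γ.source)
  have ht1 : t < 1 := lt_of_le_of_ne t.2.2 fun h => hpy (by rw [h]; exact γ.target)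
  have hN' : interior N ∈ 𝓝 (γ t) := interior_mem_nhds.2 hN
  obtain ⟨l, u, ⟨hlt, htu⟩, hlu⟩ := (mem_nhds_iff_exists_Ioo_subset' ⟨0, ht0⟩ ⟨1, ht1⟩).1
    (γ.continuous.continuousAt hN')
  obtain ⟨s, hls, hst⟩ := exists_between hlt
  obtain ⟨r, htr, hru⟩ := exists_between htu
  -- `A` is the arc obtained from the Jordan curve by cutting out a piece around `p`
  let A : Set ℂ := (γ '' Icc 0 s ∪ Q) ∪ γ '' Icc r 1
  have hs1 : s < 1 := hst.trans ht1
  have hr0 : 0 < r := ht0.trans htr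
  have cA1 : IsCompact (γ '' Icc 0 s) := isCompact_Icc.image γ.continuous
  have cA2 : IsCompact (γ '' Icc r 1) := isCompact_Icc.image γ.continuous
  have hA : LogAcyclic A := by
    refine LogAcyclic.union (p := y) (LogAcyclic.union (p := x) (logAcyclic_image_Icc γ hγ _ _)
      hQ.logAcyclic cA1.isClosed cQ ?_) (logAcyclic_image_Icc γ hγ _ _)
      (cA1.isClosed.union cQ) cA2.isClosed ?_
    · ext z
      constructor
      · rintro ⟨⟨v, hv, rfl⟩, hz⟩
        rcases hPQ _ ⟨v, rfl⟩ hz with h | h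
        · exact h
        · have : v = 1 := hγ (h.trans γ.target.symm)
          exact absurd hv.2 (this ▸ hs1.not_ge)
      · rintro rfl
        exact ⟨⟨0, ⟨le_rfl, s.2.1⟩, γ.source⟩, hQx⟩
    · ext z
      constructor
      · rintro ⟨hz | hz, ⟨v, hv, rfl⟩⟩
        · obtain ⟨w, hw, hwv⟩ := hz
          obtain rfl := hγ hwv
          exact absurd (hw.2.trans_lt (hst.trans htr)) hv.1.not_gt
        · rcases hPQ _ ⟨v, rfl⟩ hz with h | h
          · have : v = 0 := hγ (h.trans γ.source.symm)
            exact absurd hv.1 (this ▸ hr0.not_ge)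
          · exact h
      · rintro rfl
        exact ⟨Or.inr hQy, ⟨1, ⟨r.2.2, le_rfl⟩, γ.target⟩⟩
  have cA : IsCompact A := (cA1.union hQ.isCompact).union cA2
  have hAQ : ∀ z, z ∉ A → z ∉ Q := fun z hz hzQ => hz (Or.inl (Or.inr hzQ))
  have hAN : ∀ z, z ∉ A → z ∈ range γ → z ∈ interior N := by
    rintro z hz ⟨v, rfl⟩
    refine hlu ⟨hls.trans ?_, lt_trans ?_ hru⟩
    · by_contra! h
      exact hz (Or.inl (Or.inl ⟨v, ⟨v.2.1, h⟩, rfl⟩))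
    · by_contra! h
      exact hz (Or.inr ⟨v, ⟨h, v.2.2⟩, rfl⟩)
  have hpA : γ t ∉ A := by
    rintro ((⟨v, hv, hvt⟩ | h) | ⟨v, hv, hvt⟩)
    · obtain rfl := hγ hvt
      exact absurd hv.2 hst.not_ge
    · exact (hPQ _ ⟨t, rfl⟩ h).elim hpx hpy
    · obtain rfl := hγ hvt
      exact absurd hv.1 htr.not_ge
  let d : ℂ → ℂ := fun z => if z ∈ range γ then c else g z - g' z
  have hdN : ∀ z ∈ interior N, z ∉ Q → d z = c := fun z hz hzQ => by
    by_cases hzP : z ∈ range γ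
    · simp only [d, hzP, if_true]
    · simp only [d, hzP, if_false, hcon z (interior_subset hz) hzP hzQ]
  have hd : ContinuousOn d Aᶜ := by
    intro z hz
    refine ContinuousAt.continuousWithinAt ?_
    have hzQ := hAQ z hz
    by_cases hzP : z ∈ range γ
    · refine (continuousAt_const (y := c)).congr ?_
      filter_upwards [isOpen_interior.mem_nhds (hAN z hz hzP), cQ.isOpen_compl.mem_nhds hzQ]
        with w hw hw'
      exact (hdN w hw hw').symm
    · have h1 := hg.continuousOn.continuousAt (cP.isOpen_compl.mem_nhds hzP)
      have h2 := hg'.continuousOn.continuousAt (cQ.isOpen_compl.mem_nhds hzQ)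
      refine (h1.sub h2).congr ?_
      filter_upwards [cP.isOpen_compl.mem_nhds hzP] with w hw
      exact (if_neg hw).symm
  have hdc : ∀ z, z ∉ range γ → z ∉ Q → g z - g' z = c := by
    intro z hz hzQ
    have hzA : z ∉ A := by
      rintro ((h | h) | h)
      · exact hz (image_subset_range _ _ h)
      · exact hzQ h
      · exact hz (image_subset_range _ _ h)
    have := (hA.isPreconnected_compl cA).eq_of_exp_eq_one hd (fun w hw => ?_) hzA hpA
    · simp only [d] at this
      rwa [if_neg hz, if_pos (mem_range_self t)] at this
    · by_cases hwP : w ∈ range γ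
      · simp only [d, hwP, if_true, hc]
      · simp only [d, hwP, if_false, hexp w hwP (hAQ w hw)]
  refine not_hasLogOn_compl_pair hxy ⟨fun z => if z ∈ range γ then g' z + c else g z, ?_, ?_⟩
  · intro z hz
    refine ContinuousAt.continuousWithinAt ?_
    by_cases hzP : z ∈ range γ
    · have hzQ : z ∉ Q := fun h => hz (hPQ z hzP h)
      have h2 := hg'.continuousOn.continuousAt (cQ.isOpen_compl.mem_nhds hzQ)
      refine ContinuousAt.congr (f := fun w => g' w + c) (by fun_prop) ?_
      filter_upwards [cQ.isOpen_compl.mem_nhds hzQ] with w hw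
      by_cases hwP : w ∈ range γ
      · rw [if_pos hwP]
      · rw [if_neg hwP, ← hdc w hwP hw]; ring
    · refine (hg.continuousOn.continuousAt (cP.isOpen_compl.mem_nhds hzP)).congr ?_
      filter_upwards [cP.isOpen_compl.mem_nhds hzP] with w hw
      exact (if_neg hw).symm
  · intro z hz
    by_cases hzP : z ∈ range γ
    · have hzQ : z ∉ Q := fun h => hz (hPQ z hzP h)
      simp only [hzP, if_true, Complex.exp_add, hc, mul_one, hg'.exp_eq z hzQ]
    · simp only [hzP, if_false, hg.exp_eq z hzP]

/-- The complement of a Jordan curve has at most two components: restricted to the curve, the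
functions `(z - a) / (z - c)` and `(z - b) / (z - c)` have integral winding numbers, hence satisfy
a multiplicative relation up to functions with a logarithm. -/
theorem IsPlaneArc.mem_connectedComponentIn_of_three (hP : IsPlaneArc P x y)
    (hQ : IsPlaneArc Q x y) (hPQ : ∀ z ∈ P, z ∈ Q → z = x ∨ z = y) {a b c : ℂ}
    (ha : a ∈ (P ∪ Q)ᶜ) (hb : b ∈ (P ∪ Q)ᶜ) (hc : c ∈ (P ∪ Q)ᶜ) :
    b ∈ connectedComponentIn (P ∪ Q)ᶜ a ∨ c ∈ connectedComponentIn (P ∪ Q)ᶜ a ∨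
      c ∈ connectedComponentIn (P ∪ Q)ᶜ b := by
  by_contra! hcon
  obtain ⟨hab, hac, hbc⟩ := hcon
  have cK : IsCompact (P ∪ Q) := hP.isCompact.union hQ.isCompact
  have hsub : ∀ w, w ∉ P ∪ Q → ∀ z ∈ P ∪ Q, z - w ≠ 0 := by
    intro w hw z hz h0
    exact hw (sub_eq_zero.1 h0 ▸ hz)
  have logs : ∀ a, a ∉ P ∪ Q → ∃ (l l' : ℂ → ℂ) (m : ℤ), ContinuousOn l P ∧ ContinuousOn l' Q ∧
      (∀ z ∈ P, Complex.exp (l z) = (z - a) * (z - c)⁻¹) ∧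
      (∀ z ∈ Q, Complex.exp (l' z) = (z - a) * (z - c)⁻¹) ∧
      Complex.exp (l x - l' x) = 1 ∧
      l y - l' y = l x - l' x + m * (2 * Real.pi * Complex.I) := by
    intro a ha
    have hf : ContinuousOn (fun z => (z - a) * (z - c)⁻¹) (P ∪ Q) :=
      ContinuousOn.mul (by fun_prop) (ContinuousOn.inv₀ (by fun_prop) (hsub c hc))
    have hne : ∀ z ∈ P ∪ Q, (z - a) * (z - c)⁻¹ ≠ 0 := fun z hz =>
      mul_ne_zero (hsub a ha z hz) (inv_ne_zero (hsub c hc z hz))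
    obtain ⟨l, hl, el⟩ := hP.logAcyclic _ (hf.mono subset_union_left)
      fun z hz => hne z (Or.inl hz)
    obtain ⟨l', hl', el'⟩ := hQ.logAcyclic _ (hf.mono subset_union_right)
      fun z hz => hne z (Or.inr hz)
    have hx : Complex.exp (l x - l' x) = 1 := by
      rw [Complex.exp_sub, el x hP.left_mem, el' x hQ.left_mem,
        div_self (hne x (Or.inl hP.left_mem))]
    have hy : Complex.exp (l y - l' y) = 1 := by
      rw [Complex.exp_sub, el y hP.right_mem, el' y hQ.right_mem,
        div_self (hne y (Or.inl hP.right_mem))]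
    obtain ⟨i, hi⟩ := Complex.exp_eq_one_iff.1 hx
    obtain ⟨j, hj⟩ := Complex.exp_eq_one_iff.1 hy
    refine ⟨l, l', j - i, hl, hl', el, el', hx, ?_⟩
    rw [hi, hj]; push_cast; ring
  obtain ⟨l₁, l₁', m₁, c₁, c₁', e₁, e₁', h₁, w₁⟩ := logs a ha
  obtain ⟨l₂, l₂', m₂, c₂, c₂', e₂, e₂', h₂, w₂⟩ := logs b hb
  -- any combination of winding number zero has a logarithm
  have key : ∀ i j : ℤ, i * m₁ + j * m₂ = 0 → i = 0 ∧ j = 0 := by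
    intro i j hij
    refine exponents_eq_zero_of_hasLogOn cK ha hb hc hab hac hbc (k := -i - j) (by ring) ?_
    have hexp : ∀ z ∈ P ∪ Q, (z - a) ^ i * ((z - b) ^ j * (z - c) ^ (-i - j)) =
        ((z - a) * (z - c)⁻¹) ^ i * ((z - b) * (z - c)⁻¹) ^ j := by
      intro z hz
      have hzc := hsub c hc z hz
      rw [mul_zpow, mul_zpow, sub_eq_add_neg (-i), zpow_add₀ hzc, zpow_neg, zpow_neg, inv_zpow, inv_zpow]
      ring
    refine hasLogOn_union hP.isCompact.isClosed hQ.isCompact.isClosed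
      (g₁ := fun z => i * l₁ z + j * l₂ z) (g₂ := fun z => i * l₁' z + j * l₂' z)
      ((continuousOn_const.mul c₁).add (continuousOn_const.mul c₂))
      ((continuousOn_const.mul c₁').add (continuousOn_const.mul c₂'))
      (fun z hz => ?_) (fun z hz => ?_) (c := i * (l₁ x - l₁' x) + j * (l₂ x - l₂' x)) ?_ ?_
    · rw [hexp z (Or.inl hz), Complex.exp_add, Complex.exp_int_mul, Complex.exp_int_mul,
        e₁ z hz, e₂ z hz]
    · rw [hexp z (Or.inr hz), Complex.exp_add, Complex.exp_int_mul, Complex.exp_int_mul,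
        e₁' z hz, e₂' z hz]
    · rw [Complex.exp_add, Complex.exp_int_mul, Complex.exp_int_mul, h₁, h₂]
      simp
    · intro z hz hz'
      rcases hPQ z hz hz' with rfl | rfl
      · ring
      · have hij' : (i * m₁ + j * m₂ : ℂ) = 0 := by exact_mod_cast hij
        linear_combination i * w₁ + j * w₂ + (2 * Real.pi * Complex.I) * hij'
  have h := key m₂ (-m₁) (by ring)
  have h' := key 1 0 (by rw [neg_eq_zero.1 h.2]; simp)
  exact one_ne_zero h'.1

/-- Points with the same winding number lie in the same component. -/
theorem IsPlaneArc.mem_connectedComponentIn_of_sub_eq (hP : IsPlaneArc P x y)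
    (hQ : IsPlaneArc Q x y) (hPQ : ∀ z ∈ P, z ∈ Q → z = x ∨ z = y) (hg : IsArcLog g P x y)
    (hg' : IsArcLog g' Q x y) {a b : ℂ} (ha : a ∈ (P ∪ Q)ᶜ) (hb : b ∈ (P ∪ Q)ᶜ)
    (hab : g a - g' a = g b - g' b) : b ∈ connectedComponentIn (P ∪ Q)ᶜ a := by
  have hconst : ∀ u v, u ∈ (P ∪ Q)ᶜ → v ∈ connectedComponentIn (P ∪ Q)ᶜ u →
      g u - g' u = g v - g' v := fun u v hu hv =>
    hg.sub_eq hg' hP isPreconnected_connectedComponentIn (connectedComponentIn_subset _ _)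
      (mem_connectedComponentIn hu) hv
  obtain ⟨T, -, ⟨p, hpT⟩, hTP, hxT, hyT, -⟩ := hP.isPreconnected_diff
  rw [compl_union] at ha hb
  obtain ⟨c, -, hcP, hcQ, hc⟩ := hP.exists_sub_ne_near hQ hPQ hg hg' (hTP hpT)
    (fun h => hxT (h ▸ hpT)) (fun h => hyT (h ▸ hpT)) Filter.univ_mem
    (hg.exp_sub hg' hP ha.1 ha.2)
  rw [← compl_union] at ha hb
  have hcK : c ∈ (P ∪ Q)ᶜ := fun h => h.elim hcP hcQ
  rcases hP.mem_connectedComponentIn_of_three hQ hPQ ha hb hcK with h | h | h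
  · exact h
  · exact absurd (hconst a c ha h).symm hc
  · exact absurd ((hconst b c hb h).symm.trans hab.symm) hc

/-- The winding number of a Jordan curve takes at most two values. -/
theorem IsPlaneArc.sub_eq_or_sub_eq (hP : IsPlaneArc P x y)
    (hQ : IsPlaneArc Q x y) (hPQ : ∀ z ∈ P, z ∈ Q → z = x ∨ z = y) (hg : IsArcLog g P x y)
    (hg' : IsArcLog g' Q x y) {a b c : ℂ} (ha : a ∈ (P ∪ Q)ᶜ) (hb : b ∈ (P ∪ Q)ᶜ)
    (hc : c ∈ (P ∪ Q)ᶜ) (hab : g a - g' a ≠ g b - g' b) (hac : g a - g' a ≠ g c - g' c) :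
    g b - g' b = g c - g' c := by
  have hconst : ∀ u v, u ∈ (P ∪ Q)ᶜ → v ∈ connectedComponentIn (P ∪ Q)ᶜ u →
      g u - g' u = g v - g' v := fun u v hu hv =>
    hg.sub_eq hg' hP isPreconnected_connectedComponentIn (connectedComponentIn_subset _ _)
      (mem_connectedComponentIn hu) hv
  rcases hP.mem_connectedComponentIn_of_three hQ hPQ ha hb hc with h | h | h
  · exact absurd (hconst _ _ ha h) hab
  · exact absurd (hconst _ _ ha h) hac
  · exact hconst _ _ hb h

end JordanCurves

section ThetaCurves

open Set Topology unitInterval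

/-! ### Theta curves and drawings of `K₄` -/

/-- Two arcs that meet only in a common end form an arc. -/
theorem IsPlaneArc.trans {S T : Set ℂ} {x y z : ℂ} (hS : IsPlaneArc S x y) (hT : IsPlaneArc T y z)
    (h : ∀ w ∈ S, w ∈ T → w = y) : IsPlaneArc (S ∪ T) x z := by
  obtain ⟨γ, hγ, rfl⟩ := hS
  obtain ⟨δ, hδ, rfl⟩ := hT
  refine ⟨γ.trans δ, fun s t hst => ?_, Path.trans_range _ _⟩
  have key : ∀ s t : I, (s : ℝ) ≤ 1 / 2 → ¬ (t : ℝ) ≤ 1 / 2 → γ.trans δ s ≠ γ.trans δ t := by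
    intro s t hs ht hst
    rw [Path.trans_apply, Path.trans_apply, dif_pos hs, dif_neg ht] at hst
    have hy := h _ ⟨_, rfl⟩ ⟨_, hst.symm⟩
    rw [hst] at hy
    have := congrArg Subtype.val (hδ (hy.trans δ.source.symm))
    simp only [Icc.coe_zero] at this
    exact ht (by linarith)
  by_cases hs : (s : ℝ) ≤ 1 / 2 <;> by_cases ht : (t : ℝ) ≤ 1 / 2
  · rw [Path.trans_apply, Path.trans_apply, dif_pos hs, dif_pos ht] at hst
    have := congrArg Subtype.val (hγ hst)
    exact Subtype.ext (by simpa using this)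
  · exact absurd hst (key s t hs ht)
  · exact absurd hst.symm (key t s ht hs)
  · rw [Path.trans_apply, Path.trans_apply, dif_neg hs, dif_neg ht] at hst
    have := congrArg Subtype.val (hδ hst)
    exact Subtype.ext (by simpa using this)

/-- Three arcs from `x` to `y`, any two of which meet only in their ends. -/
structure IsTheta (P₁ P₂ P₃ : Set ℂ) (x y : ℂ) : Prop where
  arc₁ : IsPlaneArc P₁ x y
  arc₂ : IsPlaneArc P₂ x y
  arc₃ : IsPlaneArc P₃ x y
  inter₁₂ : ∀ z ∈ P₁, z ∈ P₂ → z = x ∨ z = y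
  inter₁₃ : ∀ z ∈ P₁, z ∈ P₃ → z = x ∨ z = y
  inter₂₃ : ∀ z ∈ P₂, z ∈ P₃ → z = x ∨ z = y

variable {P₁ P₂ P₃ : Set ℂ} {x y : ℂ} {g₁ g₂ g₃ : ℂ → ℂ}

theorem IsArcLog.sub_eq_of_mem_closure {P Q : Set ℂ} {g g' : ℂ → ℂ} (hg : IsArcLog g P x y)
    (hg' : IsArcLog g' Q x y) (hP : IsPlaneArc P x y) {S : Set ℂ} (hS : IsPreconnected S)
    (hSPQ : S ⊆ (P ∪ Q)ᶜ) {p u : ℂ} (hp : p ∈ closure S) (hpP : p ∉ P) (hpQ : p ∉ Q)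
    (hu : u ∈ S) : g p - g' p = g u - g' u := by
  refine hg.sub_eq hg' hP (hS.subset_closure (subset_insert p S) (insert_subset hp subset_closure))
    (insert_subset ?_ hSPQ) (mem_insert p S) (mem_insert_of_mem p hu)
  exact fun h => h.elim hpP hpQ

theorem IsArcLog.eventually_sub_eq {P Q : Set ℂ} {g g' : ℂ → ℂ} (hg : IsArcLog g P x y)
    (hg' : IsArcLog g' Q x y) (hP : IsPlaneArc P x y) (hQ : IsPlaneArc Q x y) {p : ℂ}
    (hpP : p ∉ P) (hpQ : p ∉ Q) :
    ∀ᶠ z in 𝓝 p, z ∉ P ∧ z ∉ Q ∧ g z - g' z = g p - g' p := by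
  have hopen : IsOpen (P ∪ Q)ᶜ :=
    (hP.isCompact.isClosed.union hQ.isCompact.isClosed).isOpen_compl
  obtain ⟨r, hr, hball⟩ := Metric.isOpen_iff.1 hopen p (fun h => h.elim hpP hpQ)
  filter_upwards [Metric.ball_mem_nhds p hr] with z hz
  have hz' := hball hz
  rw [compl_union] at hz'
  exact ⟨hz'.1, hz'.2, hg.sub_eq hg' hP Metric.isPreconnected_ball hball hz
    (Metric.mem_ball_self hr)⟩

/-- At an inner point of one arc of a theta curve, the Jordan curve formed by the other two arcs
cannot have the winding number that it has at `u`, for all three arcs at once. Near these points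
one finds points at which two of the three winding numbers `d₁₂`, `d₁₃ = d₁₂ + d₂₃`, `d₂₃` differ from
those at `u`. As each takes only two values, all differences equal one number `e` up to the sign,
and the signs force `e = -e`. -/
theorem IsTheta.false_of_sub_eq (h : IsTheta P₁ P₂ P₃ x y) (hg₁ : IsArcLog g₁ P₁ x y)
    (hg₂ : IsArcLog g₂ P₂ x y) (hg₃ : IsArcLog g₃ P₃ x y) {u p₁ p₂ p₃ : ℂ}
    (hu₁ : u ∉ P₁) (hu₂ : u ∉ P₂) (hu₃ : u ∉ P₃)
    (hp₁ : p₁ ∈ P₁) (hp₁x : p₁ ≠ x) (hp₁y : p₁ ≠ y)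
    (hp₂ : p₂ ∈ P₂) (hp₂x : p₂ ≠ x) (hp₂y : p₂ ≠ y)
    (hp₃ : p₃ ∈ P₃) (hp₃x : p₃ ≠ x) (hp₃y : p₃ ≠ y)
    (e₁ : g₂ p₁ - g₃ p₁ = g₂ u - g₃ u) (e₂ : g₁ p₂ - g₃ p₂ = g₁ u - g₃ u)
    (e₃ : g₁ p₃ - g₂ p₃ = g₁ u - g₂ u) : False := by
  obtain ⟨z₁, ⟨-, h₁3, d₁⟩, h₁1, h₁2, n₁⟩ := h.arc₁.exists_sub_ne_near h.arc₂ h.inter₁₂ hg₁ hg₂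
    hp₁ hp₁x hp₁y (hg₂.eventually_sub_eq hg₃ h.arc₂ h.arc₃
      (fun h' => (h.inter₁₂ _ hp₁ h').elim hp₁x hp₁y)
      (fun h' => (h.inter₁₃ _ hp₁ h').elim hp₁x hp₁y)) (hg₁.exp_sub hg₂ h.arc₁ hu₁ hu₂)
  obtain ⟨z₂, ⟨-, h₂3, d₂⟩, h₂2, h₂1, n₂⟩ := h.arc₂.exists_sub_ne_near h.arc₁
    (fun z hz hz' => h.inter₁₂ z hz' hz) hg₂ hg₁
    hp₂ hp₂x hp₂y (hg₁.eventually_sub_eq hg₃ h.arc₁ h.arc₃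
      (fun h' => (h.inter₁₂ _ h' hp₂).elim hp₂x hp₂y)
      (fun h' => (h.inter₂₃ _ hp₂ h').elim hp₂x hp₂y)) (hg₂.exp_sub hg₁ h.arc₂ hu₂ hu₁)
  obtain ⟨z₃, ⟨h₃1, -, d₃⟩, h₃3, h₃2, n₃⟩ := h.arc₃.exists_sub_ne_near h.arc₂
    (fun z hz hz' => h.inter₂₃ z hz' hz) hg₃ hg₂
    hp₃ hp₃x hp₃y (hg₁.eventually_sub_eq hg₂ h.arc₁ h.arc₂
      (fun h' => (h.inter₁₃ _ h' hp₃).elim hp₃x hp₃y)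
      (fun h' => (h.inter₂₃ _ h' hp₃).elim hp₃x hp₃y)) (hg₃.exp_sub hg₂ h.arc₃ hu₃ hu₂)
  have out : ∀ {A B : Set ℂ} {z : ℂ}, z ∉ A → z ∉ B → z ∈ (A ∪ B)ᶜ := fun hA hB hz =>
    hz.elim hA hB
  rw [e₁] at d₁
  rw [e₂] at d₂
  rw [e₃] at d₃
  have k₁ := h.arc₁.sub_eq_or_sub_eq h.arc₂ h.inter₁₂ hg₁ hg₂ (out hu₁ hu₂) (out h₁1 h₁2)
    (out h₂1 h₂2) n₁.symm (fun h' => n₂ (by linear_combination h'))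
  have k₂ := h.arc₁.sub_eq_or_sub_eq h.arc₃ h.inter₁₃ hg₁ hg₃ (out hu₁ hu₃) (out h₁1 h₁3)
    (out h₃1 h₃3) (fun h' => n₁ (by linear_combination -h' - d₁))
    (fun h' => n₃ (by linear_combination h' + d₃))
  have k₃ := h.arc₂.sub_eq_or_sub_eq h.arc₃ h.inter₂₃ hg₂ hg₃ (out hu₂ hu₃) (out h₂2 h₂3)
    (out h₃2 h₃3) (fun h' => n₂ (by linear_combination -h' - d₂))
    (fun h' => n₃ (by linear_combination h'))
  have e0 : 2 * (g₁ z₁ - g₂ z₁ - (g₁ u - g₂ u)) = 0 := by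
    linear_combination k₁ + k₂ - k₃ - d₁ + d₂ + d₃
  exact n₁ (sub_eq_zero.1 ((mul_eq_zero.1 e0).resolve_left two_ne_zero))

/-- No connected set off a theta curve accumulates at an inner point of each of its arcs. -/
theorem IsTheta.false_of_mem_closure (h : IsTheta P₁ P₂ P₃ x y) {F : Set ℂ}
    (hF : IsPreconnected F) (h₁ : Disjoint F P₁) (h₂ : Disjoint F P₂) (h₃ : Disjoint F P₃)
    {p₁ p₂ p₃ : ℂ}
    (hp₁ : p₁ ∈ P₁) (hp₁x : p₁ ≠ x) (hp₁y : p₁ ≠ y) (hp₁F : p₁ ∈ closure F)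
    (hp₂ : p₂ ∈ P₂) (hp₂x : p₂ ≠ x) (hp₂y : p₂ ≠ y) (hp₂F : p₂ ∈ closure F)
    (hp₃ : p₃ ∈ P₃) (hp₃x : p₃ ≠ x) (hp₃y : p₃ ≠ y) (hp₃F : p₃ ∈ closure F) : False := by
  obtain ⟨g₁, hg₁⟩ := h.arc₁.exists_isArcLog
  obtain ⟨g₂, hg₂⟩ := h.arc₂.exists_isArcLog
  obtain ⟨g₃, hg₃⟩ := h.arc₃.exists_isArcLog
  obtain ⟨u, hu⟩ : F.Nonempty := closure_nonempty_iff.1 ⟨p₁, hp₁F⟩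
  have out : ∀ {A B : Set ℂ}, Disjoint F A → Disjoint F B → F ⊆ (A ∪ B)ᶜ := fun hA hB =>
    subset_compl_iff_disjoint_right.2 (disjoint_union_right.2 ⟨hA, hB⟩)
  refine h.false_of_sub_eq hg₁ hg₂ hg₃ (h₁.notMem_of_mem_left hu) (h₂.notMem_of_mem_left hu)
    (h₃.notMem_of_mem_left hu) hp₁ hp₁x hp₁y hp₂ hp₂x hp₂y hp₃ hp₃x hp₃y
    (hg₂.sub_eq_of_mem_closure hg₃ h.arc₂ hF (out h₂ h₃) hp₁F ?_ ?_ hu)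
    (hg₁.sub_eq_of_mem_closure hg₃ h.arc₁ hF (out h₁ h₃) hp₂F ?_ ?_ hu)
    (hg₁.sub_eq_of_mem_closure hg₂ h.arc₁ hF (out h₁ h₂) hp₃F ?_ ?_ hu)
  · exact fun h' => (h.inter₁₂ _ hp₁ h').elim hp₁x hp₁y
  · exact fun h' => (h.inter₁₃ _ hp₁ h').elim hp₁x hp₁y
  · exact fun h' => (h.inter₁₂ _ h' hp₂).elim hp₂x hp₂y
  · exact fun h' => (h.inter₂₃ _ hp₂ h').elim hp₂x hp₂y
  · exact fun h' => (h.inter₁₃ _ h' hp₃).elim hp₃x hp₃y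
  · exact fun h' => (h.inter₂₃ _ h' hp₃).elim hp₃x hp₃y

/-- Two connected sets off a theta curve that accumulate at the same inner points of the first and
the third arc lie on the same side of the Jordan curve formed by these two arcs. -/
theorem IsTheta.mem_connectedComponentIn (h : IsTheta P₁ P₂ P₃ x y) {F T : Set ℂ}
    (hF : IsPreconnected F) (h₁ : Disjoint F P₁) (h₂ : Disjoint F P₂) (h₃ : Disjoint F P₃)
    (hT : IsPreconnected T) (k₁ : Disjoint T P₁) (k₂ : Disjoint T P₂) (k₃ : Disjoint T P₃)
    {p₁ p₃ : ℂ} (hp₁ : p₁ ∈ P₁) (hp₁x : p₁ ≠ x) (hp₁y : p₁ ≠ y) (hp₁F : p₁ ∈ closure F)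
    (hp₁T : p₁ ∈ closure T) (hp₃ : p₃ ∈ P₃) (hp₃x : p₃ ≠ x) (hp₃y : p₃ ≠ y)
    (hp₃F : p₃ ∈ closure F) (hp₃T : p₃ ∈ closure T) {u t : ℂ} (hu : u ∈ F) (ht : t ∈ T) :
    t ∈ connectedComponentIn (P₁ ∪ P₃)ᶜ u := by
  obtain ⟨g₁, hg₁⟩ := h.arc₁.exists_isArcLog
  obtain ⟨g₂, hg₂⟩ := h.arc₂.exists_isArcLog
  obtain ⟨g₃, hg₃⟩ := h.arc₃.exists_isArcLog
  have out : ∀ {S A B : Set ℂ}, Disjoint S A → Disjoint S B → S ⊆ (A ∪ B)ᶜ := fun hA hB =>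
    subset_compl_iff_disjoint_right.2 (disjoint_union_right.2 ⟨hA, hB⟩)
  have n₁2 : p₁ ∉ P₂ := fun h' => (h.inter₁₂ _ hp₁ h').elim hp₁x hp₁y
  have n₁3 : p₁ ∉ P₃ := fun h' => (h.inter₁₃ _ hp₁ h').elim hp₁x hp₁y
  have n₃1 : p₃ ∉ P₁ := fun h' => (h.inter₁₃ _ h' hp₃).elim hp₃x hp₃y
  have n₃2 : p₃ ∉ P₂ := fun h' => (h.inter₂₃ _ h' hp₃).elim hp₃x hp₃y
  have a₁ := hg₂.sub_eq_of_mem_closure hg₃ h.arc₂ hF (out h₂ h₃) hp₁F n₁2 n₁3 hu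
  have a₂ := hg₂.sub_eq_of_mem_closure hg₃ h.arc₂ hT (out k₂ k₃) hp₁T n₁2 n₁3 ht
  have a₃ := hg₁.sub_eq_of_mem_closure hg₂ h.arc₁ hF (out h₁ h₂) hp₃F n₃1 n₃2 hu
  have a₄ := hg₁.sub_eq_of_mem_closure hg₂ h.arc₁ hT (out k₁ k₂) hp₃T n₃1 n₃2 ht
  exact h.arc₁.mem_connectedComponentIn_of_sub_eq h.arc₃ h.inter₁₃ hg₁ hg₃ (out h₁ h₃ hu)
    (out k₁ k₃ ht) (by linear_combination a₂ - a₁ + a₄ - a₃)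

/-- In a plane drawing of the complete graph on `a`, `b`, `c`, `d`, no connected set off the drawing
accumulates at all four vertices: by `IsTheta.mem_connectedComponentIn`, the inner points of the
diagonal `ac` would lie on the same side of the four-cycle as that set, which
`IsTheta.false_of_sub_eq` excludes. -/
theorem false_of_mem_closure_of_crossing {a b c d : ℂ} {A B C D E H : Set ℂ}
    (hA : IsPlaneArc A a b) (hB : IsPlaneArc B b c) (hC : IsPlaneArc C c d) (hD : IsPlaneArc D d a)
    (hE : IsPlaneArc E a c) (hH : IsPlaneArc H b d)
    (hAB : ∀ z ∈ A, z ∈ B → z = b) (hBC : ∀ z ∈ B, z ∈ C → z = c) (hCD : ∀ z ∈ C, z ∈ D → z = d)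
    (hDA : ∀ z ∈ D, z ∈ A → z = a) (hAC : ∀ z ∈ A, z ∉ C) (hBD : ∀ z ∈ B, z ∉ D)
    (hEA : ∀ z ∈ E, z ∈ A → z = a) (hEB : ∀ z ∈ E, z ∈ B → z = c) (hEC : ∀ z ∈ E, z ∈ C → z = c)
    (hED : ∀ z ∈ E, z ∈ D → z = a) (hHA : ∀ z ∈ H, z ∈ A → z = b) (hHB : ∀ z ∈ H, z ∈ B → z = b)
    (hHC : ∀ z ∈ H, z ∈ C → z = d) (hHD : ∀ z ∈ H, z ∈ D → z = d) (hEH : ∀ z ∈ E, z ∉ H)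
    {F : Set ℂ} (hF : IsPreconnected F) (hFA : Disjoint F A) (hFB : Disjoint F B)
    (hFC : Disjoint F C) (hFD : Disjoint F D) (hFE : Disjoint F E) (hFH : Disjoint F H)
    (ha : a ∈ closure F) (hb : b ∈ closure F) (hc : c ∈ closure F) (hd : d ∈ closure F) :
    False := by
  have hab := hA.ne
  have hbc := hB.ne
  have hcd := hC.ne
  have hda := hD.ne
  have hac := hE.ne
  have hbd := hH.ne
  have θ : IsTheta (A ∪ B) E (D ∪ C) a c := by
    refine ⟨hA.trans hB hAB, hE, hD.symm.trans hC.symm fun z hz hz' => hCD z hz' hz, ?_, ?_, ?_⟩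
    · rintro z (hz | hz) hz' <;> grind
    · rintro z (hz | hz) (hz' | hz') <;> grind
    · rintro z hz (hz' | hz') <;> grind
  have θ' : IsTheta (A ∪ D) H (B ∪ C) b d := by
    refine ⟨hA.symm.trans hD.symm fun z hz hz' => hDA z hz' hz, hH, hB.trans hC hBC, ?_, ?_, ?_⟩
    · rintro z (hz | hz) hz' <;> grind
    · rintro z (hz | hz) (hz' | hz') <;> grind
    · rintro z hz (hz' | hz') <;> grind
  obtain ⟨T, hT, ⟨t, ht⟩, hTE, haT, hcT, haT', hcT'⟩ := hE.isPreconnected_diff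
  obtain ⟨u, hu⟩ : F.Nonempty := closure_nonempty_iff.1 ⟨a, ha⟩
  have kA : Disjoint T A := disjoint_left.2 fun z hz hz' => haT (hEA z (hTE hz) hz' ▸ hz)
  have kB : Disjoint T B := disjoint_left.2 fun z hz hz' => hcT (hEB z (hTE hz) hz' ▸ hz)
  have kC : Disjoint T C := disjoint_left.2 fun z hz hz' => hcT (hEC z (hTE hz) hz' ▸ hz)
  have kD : Disjoint T D := disjoint_left.2 fun z hz hz' => haT (hED z (hTE hz) hz' ▸ hz)
  have kH : Disjoint T H := disjoint_left.2 fun z hz hz' => hEH z (hTE hz) hz'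
  have hcomp := θ'.mem_connectedComponentIn hF (hFA.union_right hFD) hFH (hFB.union_right hFC)
    hT (kA.union_right kD) kH (kB.union_right kC) (Or.inl hA.left_mem) hab hda.symm ha haT'
    (Or.inl hB.right_mem) hbc.symm hcd hc hcT' hu ht
  have hunion : (A ∪ D) ∪ (B ∪ C) = (A ∪ B) ∪ (D ∪ C) := union_union_union_comm _ _ _ _
  rw [hunion] at hcomp
  obtain ⟨g₁, hg₁⟩ := θ.arc₁.exists_isArcLog
  obtain ⟨g₂, hg₂⟩ := θ.arc₂.exists_isArcLog
  obtain ⟨g₃, hg₃⟩ := θ.arc₃.exists_isArcLog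
  have out : ∀ {S A B : Set ℂ}, Disjoint S A → Disjoint S B → S ⊆ (A ∪ B)ᶜ := fun hA hB =>
    subset_compl_iff_disjoint_right.2 (disjoint_union_right.2 ⟨hA, hB⟩)
  have h₁ := hFA.union_right hFB
  have h₃ := hFD.union_right hFC
  have hbmem : b ∈ A ∪ B := Or.inl hA.right_mem
  have hdmem : d ∈ D ∪ C := Or.inl hD.left_mem
  refine θ.false_of_sub_eq hg₁ hg₂ hg₃ (h₁.notMem_of_mem_left hu) (hFE.notMem_of_mem_left hu)
    (h₃.notMem_of_mem_left hu) hbmem hab.symm hbc (hTE ht)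
    (fun h => haT (h ▸ ht)) (fun h => hcT (h ▸ ht)) hdmem hda hcd.symm
    (hg₂.sub_eq_of_mem_closure hg₃ θ.arc₂ hF (out hFE h₃) hb ?_ ?_ hu)
    (hg₁.sub_eq hg₃ θ.arc₁ isPreconnected_connectedComponentIn (connectedComponentIn_subset _ _)
      hcomp (mem_connectedComponentIn (out h₁ h₃ hu)))
    (hg₁.sub_eq_of_mem_closure hg₂ θ.arc₁ hF (out h₁ hFE) hd ?_ ?_ hu)
  · exact fun h => (θ.inter₁₂ _ hbmem h).elim hab.symm hbc
  · exact fun h => (θ.inter₁₃ _ hbmem h).elim hab.symm hbc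
  · exact fun h => (θ.inter₁₃ _ h hdmem).elim hda hcd.symm
  · exact fun h => (θ.inter₂₃ _ h hdmem).elim hda hcd.symm

end ThetaCurves

section Obstructions

open Set

/-! ### Forbidden subgraphs of outerplanar graphs -/

namespace SimpleGraph

variable {V : Type*} {G : SimpleGraph V}

/-- The part of a drawing that is covered by the edges between consecutive vertices of a list. -/
def PlaneDrawing.track (D : G.PlaneDrawing) : List V → Set ℂ
  | a :: b :: l => D.arc s(a, b) ∪ D.track (b :: l)
  | _ => ∅

namespace PlaneDrawing

variable (D : G.PlaneDrawing)

theorem exists_of_mem_track {l : List V} (hl : l.IsChain G.Adj) {z : ℂ} (hz : z ∈ D.track l) :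
    ∃ u w, u ∈ l ∧ w ∈ l ∧ G.Adj u w ∧ z ∈ D.arc s(u, w) := by
  induction l with
  | nil => exact hz.elim
  | cons a l ih =>
    cases l with
    | nil => exact hz.elim
    | cons b l =>
      rw [List.isChain_cons_cons] at hl
      rcases hz with hz | hz
      · exact ⟨a, b, by simp, by simp, hl.1, hz⟩
      · obtain ⟨u, w, hu, hw, h⟩ := ih hl.2 hz
        exact ⟨u, w, List.mem_cons_of_mem _ hu, List.mem_cons_of_mem _ hw, h⟩

/-- If two paths have at most one common vertex, then their drawings meet at most there. -/
theorem exists_of_mem_track_inter {l l' : List V} (hl : l.IsChain G.Adj) (hl' : l'.IsChain G.Adj)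
    (h : ∀ u ∈ l, u ∈ l' → ∀ w ∈ l, w ∈ l' → u = w) {z : ℂ} (hz : z ∈ D.track l)
    (hz' : z ∈ D.track l') : ∃ v ∈ l, v ∈ l' ∧ D.pos v = z := by
  obtain ⟨u, w, hu, hw, huw, hzu⟩ := D.exists_of_mem_track hl hz
  obtain ⟨u', w', hu', hw', huw', hzu'⟩ := D.exists_of_mem_track hl' hz'
  have hne : s(u, w) ≠ s(u', w') := by
    intro he
    rcases Sym2.eq_iff.1 he with ⟨rfl, rfl⟩ | ⟨rfl, rfl⟩
    · exact huw.ne (h u hu hu' w hw hw')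
    · exact huw.ne (h u hu hw' w hw hu')
  obtain ⟨v, hv, hv', hvz⟩ := D.arc_inter _ huw _ huw' hne z ⟨hzu, hzu'⟩
  refine ⟨v, ?_, ?_, hvz⟩
  · rcases Sym2.mem_iff.1 hv with rfl | rfl <;> assumption
  · rcases Sym2.mem_iff.1 hv' with rfl | rfl <;> assumption

theorem isPlaneArc_track {a b : V} {l : List V} (hl : (a :: l ++ [b]).IsChain G.Adj)
    (hn : (a :: l ++ [b]).Nodup) : IsPlaneArc (D.track (a :: l ++ [b])) (D.pos a) (D.pos b) := by
  induction l generalizing a with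
  | nil =>
    have : D.track [a, b] = D.arc s(a, b) := union_empty _
    rw [List.cons_append, List.nil_append, this]
    exact D.isPlaneArc a b (by simpa using hl)
  | cons c l ih =>
    have hl' : (c :: l ++ [b]).IsChain G.Adj := by
      simp only [List.cons_append, List.isChain_cons_cons] at hl ⊢; exact hl.2
    have hn' : (c :: l ++ [b]).Nodup := by
      simp only [List.cons_append] at hn ⊢; exact (List.nodup_cons.1 hn).2
    have hac : G.Adj a c := by
      simp only [List.cons_append, List.isChain_cons_cons] at hl; exact hl.1
    refine (D.isPlaneArc a c hac).trans (ih hl' hn') fun z hz hz' => ?_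
    have han : a ∉ c :: l ++ [b] := by
      simp only [List.cons_append] at hn ⊢; exact (List.nodup_cons.1 hn).1
    have hcom : ∀ u ∈ [a, c], u ∈ c :: l ++ [b] → u = c := by
      intro u hu hu'
      rcases List.mem_cons.1 hu with rfl | hu
      · exact absurd hu' han
      · simpa using hu
    obtain ⟨v, hv, hv', rfl⟩ := D.exists_of_mem_track_inter (l := [a, c]) (by simpa using hac) hl'
      (fun u hu hu' w hw hw' => (hcom u hu hu').trans (hcom w hw hw').symm) (Or.inl hz) hz'
    rw [hcom v hv hv']

theorem track_subset_support {l : List V} (hl : l.IsChain G.Adj) : D.track l ⊆ D.support := by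
  intro z hz
  obtain ⟨u, w, -, -, huw, hzu⟩ := D.exists_of_mem_track hl hz
  exact Or.inr (mem_iUnion₂.2 ⟨s(u, w), huw, hzu⟩)

theorem pos_mem_track {l : List V} (hl : l.IsChain G.Adj) (h2 : 2 ≤ l.length) {v : V}
    (hv : v ∈ l) : D.pos v ∈ D.track l := by
  induction l with
  | nil => simp at hv
  | cons a l ih =>
    cases l with
    | nil => simp at h2
    | cons b l =>
      rw [List.isChain_cons_cons] at hl
      have harc := D.isPlaneArc a b hl.1
      rcases List.mem_cons.1 hv with rfl | hv
      · exact Or.inl harc.left_mem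
      · cases l with
        | nil =>
          obtain rfl : v = b := by simpa using hv
          exact Or.inl harc.right_mem
        | cons c l => exact Or.inr (ih hl.2 (by simp) hv)

end PlaneDrawing

/-- `G` has no two vertices joined by three internally disjoint paths with inner vertices, that is,
no subdivision of `K₂,₃` as a subgraph. -/
def ThetaFree (G : SimpleGraph V) : Prop :=
  ∀ (x y : V) (A B C : List V), A ≠ [] → B ≠ [] → C ≠ [] →
    (x :: A ++ [y]).Nodup → (x :: B ++ [y]).Nodup → (x :: C ++ [y]).Nodup →
    (∀ u ∈ A, u ∉ B) → (∀ u ∈ A, u ∉ C) → (∀ u ∈ B, u ∉ C) →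
    (x :: A ++ [y]).IsChain G.Adj → (x :: B ++ [y]).IsChain G.Adj →
      (x :: C ++ [y]).IsChain G.Adj → False

/-- No cycle of `G` has two crossing chords. -/
def CrossingChordFree (G : SimpleGraph V) : Prop :=
  ∀ (a b c d : V) (A B C D : List V),
    (a :: A ++ b :: B ++ c :: C ++ d :: D).Nodup → (a :: A ++ [b]).IsChain G.Adj →
      (b :: B ++ [c]).IsChain G.Adj → (c :: C ++ [d]).IsChain G.Adj →
        (d :: D ++ [a]).IsChain G.Adj → G.Adj a c → G.Adj b d → False

theorem PlaneDrawing.IsFace.isPreconnected {D : G.PlaneDrawing} {F : Set ℂ} (hF : D.IsFace F) :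
    IsPreconnected F := by
  obtain ⟨x, -, rfl⟩ := hF
  exact isPreconnected_connectedComponentIn

theorem PlaneDrawing.IsFace.disjoint_track {D : G.PlaneDrawing} {F : Set ℂ} (hF : D.IsFace F)
    {l : List V} (hl : l.IsChain G.Adj) : Disjoint F (D.track l) := by
  obtain ⟨x, -, rfl⟩ := hF
  exact (disjoint_compl_left.mono_left (connectedComponentIn_subset _ _)).mono_right
    (D.track_subset_support hl)

theorem IsOuterplanar.thetaFree (hG : G.IsOuterplanar) : G.ThetaFree := by
  obtain ⟨D, F, ⟨hF, -⟩, hfr⟩ := hG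
  rintro x y (_ | ⟨a, A⟩) (_ | ⟨b, B⟩) (_ | ⟨c, C⟩) hA hB hC nA nB nC dAB dAC dBC cA cB cC
  all_goals try contradiction
  have inter : ∀ (a : V) (A l : List V), (x :: a :: A ++ [y]).IsChain G.Adj →
      l.IsChain G.Adj → (x :: a :: A ++ [y]).Nodup →
      (∀ u ∈ a :: A, u ∉ l) → ∀ z ∈ D.track (x :: a :: A ++ [y]), z ∈ D.track l →
      z = D.pos x ∨ z = D.pos y := by
    intro a A l cA cl hn hd z hz hz'
    simp only [List.cons_append, List.isChain_cons_cons] at cA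
    rcases hz with hz | hz
    · have hcom : ∀ u ∈ [x, a], u ∈ l → u = x := by grind
      obtain ⟨v, hv, hv', rfl⟩ := D.exists_of_mem_track_inter (l := [x, a]) (by simpa using cA.1) cl
        (fun u hu hu' w hw hw' => (hcom u hu hu').trans (hcom w hw hw').symm) (Or.inl hz) hz'
      exact Or.inl (by rw [hcom v hv hv'])
    · have hcom : ∀ u ∈ a :: A ++ [y], u ∈ l → u = y := by grind
      obtain ⟨v, hv, hv', rfl⟩ := D.exists_of_mem_track_inter cA.2 cl
        (fun u hu hu' w hw hw' => (hcom u hu hu').trans (hcom w hw hw').symm) hz hz'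
      exact Or.inr (by rw [hcom v hv hv'])
  have ends : ∀ (a : V) (A : List V), (x :: a :: A ++ [y]).Nodup → a ≠ x ∧ a ≠ y ∧
      ∀ u ∈ a :: A, u ≠ x ∧ u ≠ y := by
    intro a A hn
    simp only [List.cons_append, List.nodup_cons, List.nodup_append, List.mem_cons,
      List.mem_append] at hn ⊢
    grind only
  obtain ⟨hax, hay, hA'⟩ := ends a A nA
  obtain ⟨hbx, hby, hB'⟩ := ends b B nB
  obtain ⟨hcx, hcy, -⟩ := ends c C nC
  have dis : ∀ (A B : List V), (∀ u ∈ A, u ≠ x ∧ u ≠ y) → (∀ u ∈ A, u ∉ B) →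
      ∀ u ∈ A, u ∉ x :: B ++ [y] := by
    intro A B h h' u hu
    simp only [List.cons_append, List.mem_cons, List.mem_append]
    have := h u hu
    have := h' u hu
    grind only [List.not_mem_nil]
  have θ : IsTheta (D.track (x :: (a :: A) ++ [y])) (D.track (x :: (b :: B) ++ [y]))
      (D.track (x :: (c :: C) ++ [y])) (D.pos x) (D.pos y) :=
    ⟨D.isPlaneArc_track cA nA, D.isPlaneArc_track cB nB, D.isPlaneArc_track cC nC,
      inter a A _ cA cB nA (dis _ _ hA' dAB), inter a A _ cA cC nA (dis _ _ hA' dAC),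
      inter b B _ cB cC nB (dis _ _ hB' dBC)⟩
  have hcl : ∀ v, D.pos v ∈ closure F := fun v => (hfr v).1
  have hne : ∀ {u v : V}, u ≠ v → D.pos u ≠ D.pos v := fun h => D.pos_injective.ne h
  exact θ.false_of_mem_closure hF.isPreconnected (hF.disjoint_track cA) (hF.disjoint_track cB)
    (hF.disjoint_track cC)
    (D.pos_mem_track cA (by simp) (v := a) (by simp)) (hne hax) (hne hay) (hcl _)
    (D.pos_mem_track cB (by simp) (v := b) (by simp)) (hne hbx) (hne hby) (hcl _)
    (D.pos_mem_track cC (by simp) (v := c) (by simp)) (hne hcx) (hne hcy) (hcl _)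

theorem IsOuterplanar.crossingChordFree (hG : G.IsOuterplanar) : G.CrossingChordFree := by
  obtain ⟨Δ, F, ⟨hF, -⟩, hfr⟩ := hG
  intro a b c d A B C D hn cA cB cC cD hac hbd
  have hcl : ∀ v, Δ.pos v ∈ closure F := fun v => (hfr v).1
  simp only [List.cons_append, List.append_assoc, List.nodup_cons, List.nodup_append,
    List.mem_cons, List.mem_append, not_or] at hn
  have nA : (a :: A ++ [b]).Nodup := by
    simp only [List.cons_append, List.nodup_cons, List.nodup_append, List.mem_cons,
      List.mem_append, List.not_mem_nil]
    grind only [List.nodup_nil]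
  have nB : (b :: B ++ [c]).Nodup := by
    simp only [List.cons_append, List.nodup_cons, List.nodup_append, List.mem_cons,
      List.mem_append, List.not_mem_nil]
    grind only [List.nodup_nil]
  have nC : (c :: C ++ [d]).Nodup := by
    simp only [List.cons_append, List.nodup_cons, List.nodup_append, List.mem_cons,
      List.mem_append, List.not_mem_nil]
    grind only [List.nodup_nil]
  have nD : (d :: D ++ [a]).Nodup := by
    simp only [List.cons_append, List.nodup_cons, List.nodup_append, List.mem_cons,
      List.mem_append, List.not_mem_nil]
    grind only [List.nodup_nil]
  have nE : (a :: [] ++ [c]).Nodup := by simp; grind only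
  have nH : (b :: [] ++ [d]).Nodup := by simp; grind only
  have cE : (a :: [] ++ [c]).IsChain G.Adj := by simpa using hac
  have cH : (b :: [] ++ [d]).IsChain G.Adj := by simpa using hbd
  have one : ∀ (v : V) (l l' : List V), l.IsChain G.Adj → l'.IsChain G.Adj →
      (∀ u ∈ l, u ∈ l' → u = v) → ∀ z ∈ Δ.track l, z ∈ Δ.track l' → z = Δ.pos v := by
    intro v l l' hl hl' h z hz hz'
    obtain ⟨u, hu, hu', rfl⟩ := Δ.exists_of_mem_track_inter hl hl'
      (fun u hu hu' w hw hw' => (h u hu hu').trans (h w hw hw').symm) hz hz'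
    rw [h u hu hu']
  have none : ∀ (l l' : List V), l.IsChain G.Adj → l'.IsChain G.Adj →
      (∀ u ∈ l, u ∉ l') → ∀ z ∈ Δ.track l, z ∉ Δ.track l' := by
    intro l l' hl hl' h z hz hz'
    obtain ⟨u, hu, hu', -⟩ := Δ.exists_of_mem_track_inter hl hl'
      (fun u hu hu' => absurd hu' (h u hu)) hz hz'
    exact h u hu hu'
  refine false_of_mem_closure_of_crossing
    (Δ.isPlaneArc_track cA nA) (Δ.isPlaneArc_track cB nB) (Δ.isPlaneArc_track cC nC)
    (Δ.isPlaneArc_track cD nD)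
    (Δ.isPlaneArc_track cE nE) (Δ.isPlaneArc_track cH nH)
    (one b _ _ cA cB ?_) (one c _ _ cB cC ?_) (one d _ _ cC cD ?_)
    (one a _ _ cD cA ?_) (none _ _ cA cC ?_) (none _ _ cB cD ?_)
    (one a _ _ cE cA ?_) (one c _ _ cE cB ?_) (one c _ _ cE cC ?_)
    (one a _ _ cE cD ?_) (one b _ _ cH cA ?_) (one b _ _ cH cB ?_)
    (one d _ _ cH cC ?_) (one d _ _ cH cD ?_) (none _ _ cE cH ?_)
    hF.isPreconnected (hF.disjoint_track cA) (hF.disjoint_track cB) (hF.disjoint_track cC)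
    (hF.disjoint_track cD) (hF.disjoint_track cE) (hF.disjoint_track cH)
    (hcl a) (hcl b) (hcl c) (hcl d)
  all_goals
    simp only [List.cons_append, List.mem_cons, List.mem_append, List.not_mem_nil]
    grind only

end SimpleGraph

end Obstructions

/-! ### Noncrossing vertex orders -/

namespace SimpleGraph

variable {V : Type*} {G : SimpleGraph V}

/-- No two edges of `G` cross when the vertices in `l` are placed on a circle in this order. -/
def NonCrossing (G : SimpleGraph V) (l : List V) : Prop :=
  ∀ a b c d, [a, b, c, d].Sublist l → G.Adj a c → ¬ G.Adj b d

theorem sublist_append_cases {a b c d : V} {l l' : List V}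
    (h : [a, b, c, d].Sublist (l ++ l')) :
    [a, b, c, d].Sublist l' ∨ (a ∈ l ∧ [b, c, d].Sublist l') ∨
      ([a, b].Sublist l ∧ [c, d].Sublist l') ∨ ([a, b, c].Sublist l ∧ d ∈ l') ∨
        [a, b, c, d].Sublist l := by
  obtain ⟨s, t, hst, hs, ht⟩ := List.sublist_append_iff.1 h
  rcases s with _ | ⟨s₁, _ | ⟨s₂, _ | ⟨s₃, _ | ⟨s₄, s⟩⟩⟩⟩
  · simp only [List.nil_append] at hst
    exact Or.inl (hst ▸ ht)
  · simp only [List.cons_append, List.nil_append, List.cons.injEq] at hst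
    obtain ⟨rfl, rfl⟩ := hst
    exact Or.inr (Or.inl ⟨List.singleton_sublist.1 hs, ht⟩)
  · simp only [List.cons_append, List.nil_append, List.cons.injEq] at hst
    obtain ⟨rfl, rfl, rfl⟩ := hst
    exact Or.inr (Or.inr (Or.inl ⟨hs, ht⟩))
  · simp only [List.cons_append, List.nil_append, List.cons.injEq] at hst
    obtain ⟨rfl, rfl, rfl, rfl⟩ := hst
    exact Or.inr (Or.inr (Or.inr (Or.inl ⟨hs, List.singleton_sublist.1 ht⟩)))
  · simp only [List.cons_append, List.cons.injEq] at hst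
    obtain ⟨rfl, rfl, rfl, rfl, h0⟩ := hst
    obtain ⟨rfl, rfl⟩ := List.append_eq_nil_iff.1 h0.symm
    exact Or.inr (Or.inr (Or.inr (Or.inr hs)))

theorem NonCrossing.rotate {l l' : List V} (h : G.NonCrossing (l ++ l')) :
    G.NonCrossing (l' ++ l) := by
  intro a b c d hs hac hbd
  have app : ∀ {s t : List V}, s.Sublist l → t.Sublist l' → (s ++ t).Sublist (l ++ l') :=
    fun hs ht => hs.append ht
  rcases sublist_append_cases hs with h' | ⟨h₁, h₂⟩ | ⟨h₁, h₂⟩ | ⟨h₁, h₂⟩ | h'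
  · exact h a b c d (h'.trans (List.sublist_append_left _ _)) hac hbd
  · exact h b c d a (app h₂ (List.singleton_sublist.2 h₁)) hbd hac.symm
  · exact h c d a b (app h₂ h₁) hac.symm hbd.symm
  · exact h d a b c (app (List.singleton_sublist.2 h₂) h₁) hbd.symm hac
  · exact h a b c d (h'.trans (List.sublist_append_right _ _)) hac hbd

/-- Noncrossing orders of two parts of a graph can be joined at a cut vertex. -/
theorem NonCrossing.append_cons {l l' : List V} {v : V} (h : G.NonCrossing (l ++ [v]))
    (h' : G.NonCrossing (v :: l')) (hv : v ∉ l') (hvl : v ∉ l)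
    (hll : ∀ u ∈ l, ∀ w ∈ l', ¬ G.Adj u w) : G.NonCrossing (l ++ v :: l') := by
  intro a b c d hs hac hbd
  have two : ∀ {s t : V}, [s, t].Sublist (v :: l') → t ∈ l' := by
    intro s t hst
    rcases List.cons_sublist_cons'.1 hst with h1 | ⟨-, h1⟩
    · exact h1.subset (by simp)
    · exact List.singleton_sublist.1 h1
  rcases sublist_append_cases hs with hs | ⟨h₁, h₂⟩ | ⟨h₁, h₂⟩ | ⟨h₁, h₂⟩ | hs
  · exact h' a b c d hs hac hbd
  · exact hll a h₁ c (two ((List.sublist_append_left [b, c] [d]).trans h₂)) hac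
  · exact hll b (h₁.subset (by simp)) d (two h₂) hbd
  · rcases List.mem_cons.1 h₂ with rfl | hd
    · exact h a b c d (h₁.append (List.Sublist.refl [d])) hac hbd
    · exact hll b (h₁.subset (by simp)) d hd hbd
  · exact h a b c d (hs.trans (List.sublist_append_left _ _)) hac hbd

theorem cycle_chain_iff {u t : V} {X Y : List V} :
    ((u :: (X ++ t :: Y) : List V) : Cycle V).Chain G.Adj ↔
      (u :: X ++ [t]).IsChain G.Adj ∧ (t :: Y ++ [u]).IsChain G.Adj := by
  rw [Cycle.chain_coe_cons]
  have : u :: (X ++ t :: Y ++ [u]) = (u :: X) ++ t :: (Y ++ [u]) := by simp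
  rw [this, List.isChain_split]
  rfl

theorem isChain_reverse_of_isChain {a b : V} {l : List V} (h : (a :: l ++ [b]).IsChain G.Adj) :
    (b :: l.reverse ++ [a]).IsChain G.Adj := by
  have h' : (a :: l ++ [b]).reverse.IsChain G.Adj :=
    List.isChain_reverse.2 (h.imp fun _ _ h => h.symm)
  simpa using h'

/-- `S` cannot be split into two parts without edges between them by deleting one vertex. -/
def NoCutVertex (G : SimpleGraph V) (S : Set V) : Prop :=
  ∀ v ∈ S, ∀ A B : Set V, A.Nonempty → B.Nonempty → Disjoint A B → A ∪ B = S \ {v} →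
    ∃ u ∈ A, ∃ w ∈ B, G.Adj u w

/-- A cycle that misses a vertex has an ear. -/
theorem NoCutVertex.exists_ear {S : Set V} (hS : G.NoCutVertex S) {C : List V}
    (hCS : ∀ x ∈ C, x ∈ S) (hC : C.Nodup) (h2 : 2 ≤ C.length) (hne : ∃ w ∈ S, w ∉ C) :
    ∃ u ∈ C, ∃ t ∈ C, t ≠ u ∧ ∃ W : List V, W ≠ [] ∧ W.Nodup ∧ (∀ x ∈ W, x ∈ S ∧ x ∉ C) ∧
      (t :: W ++ [u]).IsChain G.Adj := by
  classical
  have hother : ∀ v, ∃ x ∈ C, x ≠ v := by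
    intro v
    by_contra! h
    rcases C with _ | ⟨x, _ | ⟨y, C⟩⟩
    · simp at h2
    · simp at h2
    · have hx := h x (by simp)
      have hy := h y (by simp)
      simp [hx, hy] at hC
  obtain ⟨v, hv⟩ : ∃ v, v ∈ C := List.exists_mem_of_length_pos (by omega)
  -- some vertex of the cycle has a neighbor outside
  obtain ⟨u, ⟨huC, -⟩, w, ⟨hwS, hwC⟩, huw⟩ := hS v (hCS v hv) {x | x ∈ C ∧ x ≠ v}
    {x | x ∈ S ∧ x ∉ C} (hother v) hne
    (Set.disjoint_left.2 fun x hx hx' => hx'.2 hx.1) (by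
      ext x
      simp only [Set.mem_union, Set.mem_ofPred_eq, Set.mem_sdiff, Set.mem_singleton_iff]
      by_cases hxC : x ∈ C
      · simp [hxC, hCS x hxC]
      · have : x ≠ v := fun h => hxC (h ▸ hv)
        simp [hxC, this])
  -- `R` is the set of vertices from which `u` can be reached outside the cycle
  let R : Set V := {s | ∃ W : List V, (s :: W).Nodup ∧ (∀ x ∈ s :: W, x ∈ S ∧ x ∉ C) ∧
    (s :: W ++ [u]).IsChain G.Adj}
  have hRSC : ∀ s ∈ R, s ∈ S ∧ s ∉ C := fun s ⟨W, _, h, _⟩ => h s (by simp)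
  have hwR : w ∈ R := ⟨[], by simp, by simp [hwS, hwC], by simpa using huw.symm⟩
  obtain ⟨x, hxC, hxu⟩ := hother u
  obtain ⟨s, hsR, t, ⟨⟨htS, htu⟩, htR⟩, hst⟩ := hS u (hCS u huC) R ((S \ {u}) \ R) ⟨w, hwR⟩
    ⟨x, ⟨hCS x hxC, hxu⟩, fun h => (hRSC x h).2 hxC⟩ Set.disjoint_sdiff_right
    (Set.union_sdiff_cancel fun s hs => ⟨(hRSC s hs).1, fun h => (hRSC s hs).2 (h ▸ huC)⟩)
  obtain ⟨W, hWn, hWS, hWc⟩ := hsR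
  have htC : t ∈ C := by
    by_contra htC
    refine htR ?_
    by_cases htW : t ∈ s :: W
    · obtain ⟨p, q, hpq⟩ := List.append_of_mem htW
      refine ⟨q, ?_, fun x hx => hWS x (by rw [hpq]; exact List.mem_append_right _ hx), ?_⟩
      · rw [hpq] at hWn
        exact (List.nodup_append.1 hWn).2.1
      · rw [hpq, List.append_assoc] at hWc
        exact hWc.right_of_append
    · refine ⟨s :: W, List.nodup_cons.2 ⟨htW, hWn⟩, ?_, ?_⟩
      · intro x hx
        rcases List.mem_cons.1 hx with rfl | hx
        · exact ⟨htS, htC⟩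
        · exact hWS x hx
      · simpa using ⟨hst.symm, by simpa using hWc⟩
  refine ⟨u, huC, t, htC, htu, s :: W, by simp, hWn, hWS, ?_⟩
  simpa using ⟨hst.symm, by simpa using hWc⟩

/-- In a graph without `K₂,₃`-subdivisions, the ends of an ear are consecutive on the cycle, so
that the cycle can be extended. -/
theorem NoCutVertex.exists_longer_cycle {S : Set V} (hS : G.NoCutVertex S) (hθ : G.ThetaFree)
    {C : List V} (hCS : ∀ x ∈ C, x ∈ S) (hC : C.Nodup) (hCc : (C : Cycle V).Chain G.Adj)
    (h2 : 2 ≤ C.length) (hne : ∃ w ∈ S, w ∉ C) :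
    ∃ C' : List V, (∀ x ∈ C', x ∈ S) ∧ C'.Nodup ∧ (C' : Cycle V).Chain G.Adj ∧
      C.length < C'.length := by
  obtain ⟨u, huC, t, htC, htu, W, hW0, hWn, hWS, hWc⟩ := hS.exists_ear hCS hC h2 hne
  obtain ⟨p, q, rfl⟩ := List.append_of_mem huC
  have hrot : (u :: (q ++ p)).Perm (p ++ u :: q) := (List.perm_append_comm (l₁ := u :: q))
  obtain ⟨A, B, hAB⟩ : ∃ A B, q ++ p = A ++ t :: B := by
    refine List.append_of_mem ?_
    have := hrot.mem_iff.2 htC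
    exact (List.mem_cons.1 this).resolve_left htu
  have hrotc : ((p ++ u :: q : List V) : Cycle V) = ((u :: (q ++ p) : List V) : Cycle V) :=
    Cycle.coe_eq_coe.2 (List.isRotated_append (l := p) (l' := u :: q))
  rw [hrotc, hAB, cycle_chain_iff] at hCc
  rw [hAB] at hrot
  have hn : (u :: (A ++ t :: B)).Nodup := hrot.nodup_iff.2 hC
  have hmem : ∀ x, x ∈ u :: (A ++ t :: B) → x ∈ S := fun x hx => hCS x (hrot.mem_iff.1 hx)
  have hWd : ∀ x ∈ W, x ∉ u :: (A ++ t :: B) := fun x hx h => (hWS x hx).2 (hrot.mem_iff.1 h)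
  have hlen : (p ++ u :: q).length = A.length + B.length + 2 := by
    rw [← hrot.length_eq]; simp; omega
  have hWl : 0 < W.length := List.length_pos_iff.2 hW0
  rw [hlen]
  simp only [List.nodup_cons, List.nodup_append, List.mem_cons, List.mem_append, not_or]
    at hn hWd hmem
  by_cases hA : A = []
  · subst hA
    refine ⟨t :: (B ++ u :: W.reverse), ?_, ?_, ?_, ?_⟩
    · intro x hx
      simp only [List.mem_cons, List.mem_append, List.mem_reverse] at hx
      have := hWS x
      have := hmem x
      grind only
    · simp only [List.nodup_cons, List.nodup_append, List.mem_cons, List.mem_append,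
        List.mem_reverse, not_or, List.nodup_reverse]
      grind only
    · exact cycle_chain_iff.2 ⟨hCc.2, isChain_reverse_of_isChain hWc⟩
    · simp; omega
  by_cases hB : B = []
  · subst hB
    refine ⟨u :: (A ++ t :: W), ?_, ?_, ?_, ?_⟩
    · intro x hx
      simp only [List.mem_cons, List.mem_append] at hx
      have := hWS x
      have := hmem x
      grind only
    · simp only [List.nodup_cons, List.nodup_append, List.mem_cons, List.mem_append, not_or]
      grind only
    · exact cycle_chain_iff.2 ⟨hCc.1, hWc⟩
    · simp; omega
  · refine (hθ u t A B.reverse W.reverse hA (by simpa using hB) (by simpa using hW0) ?_ ?_ ?_ ?_ ?_ ?_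
      hCc.1 (isChain_reverse_of_isChain hCc.2) (isChain_reverse_of_isChain hWc)).elim
    all_goals
      simp only [List.cons_append, List.nodup_cons, List.nodup_append, List.mem_cons,
        List.mem_append, List.mem_reverse, not_or, List.nodup_reverse, List.not_mem_nil]
      grind only [List.nodup_nil]

theorem NoCutVertex.exists_hamiltonian_cycle {S : Finset V} (hS : G.NoCutVertex (S : Set V))
    (hθ : G.ThetaFree) (h3 : 3 ≤ S.card) :
    ∃ C : List V, (∀ x, x ∈ C ↔ x ∈ S) ∧ C.Nodup ∧ (C : Cycle V).Chain G.Adj := by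
  classical
  have key : ∀ k, 2 ≤ k → k ≤ S.card → ∃ C : List V, (∀ x ∈ C, x ∈ (S : Set V)) ∧ C.Nodup ∧
      (C : Cycle V).Chain G.Adj ∧ k ≤ C.length := by
    intro k hk
    induction k, hk using Nat.le_induction with
    | base =>
      intro _
      obtain ⟨v, hv⟩ : S.Nonempty := Finset.card_pos.1 (by omega)
      obtain ⟨x, hx, y, hy, hxy⟩ := Finset.one_lt_card.1
        (show 1 < (S.erase v).card by rw [Finset.card_erase_of_mem hv]; omega)
      rw [Finset.mem_erase] at hx hy
      obtain ⟨a, rfl, b, ⟨⟨hb, -⟩, -⟩, hab⟩ := hS v hv {x} (((S : Set V) \ {v}) \ {x})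
        (Set.singleton_nonempty x) ⟨y, ⟨hy.2, hy.1⟩, hxy.symm⟩ Set.disjoint_sdiff_right
        (Set.union_sdiff_cancel (Set.singleton_subset_iff.2 ⟨hx.2, hx.1⟩))
      refine ⟨[a, b], ?_, by simp [hab.ne], ?_, le_rfl⟩
      · intro z hz
        rcases List.mem_pair.1 hz with rfl | rfl
        · exact hx.2
        · exact hb
      · exact cycle_chain_iff (X := []) (Y := []) |>.2 ⟨by simpa using hab, by simpa using hab.symm⟩
    | succ k hk ih =>
      intro hkS
      obtain ⟨C, hCS, hC, hCc, hCl⟩ := ih (by omega)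
      rcases hCl.lt_or_eq with h | h
      · exact ⟨C, hCS, hC, hCc, h⟩
      · obtain ⟨w, hw, hwC⟩ : ∃ w ∈ S, w ∉ C := by
          by_contra! hall
          have h1 : S ⊆ C.toFinset := fun x hx => List.mem_toFinset.2 (hall x hx)
          have h2 := (Finset.card_le_card h1).trans C.toFinset_card_le
          omega
        obtain ⟨C', hCS', hC', hCc', hl⟩ := hS.exists_longer_cycle hθ hCS hC hCc (by omega)
          ⟨w, hw, hwC⟩
        exact ⟨C', hCS', hC', hCc', by omega⟩
  obtain ⟨C, hCS, hC, hCc, hCl⟩ := key S.card (by omega) le_rfl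
  refine ⟨C, fun x => ⟨hCS x, fun hx => ?_⟩, hC, hCc⟩
  have : C.toFinset = S := by
    refine Finset.eq_of_subset_of_card_le (fun y hy => hCS y (List.mem_toFinset.1 hy)) ?_
    rwa [List.toFinset_card_of_nodup hC]
  exact List.mem_toFinset.1 (this ▸ hx)

theorem CrossingChordFree.nonCrossing (hX : G.CrossingChordFree) {C : List V} (hC : C.Nodup)
    (hCc : (C : Cycle V).Chain G.Adj) : G.NonCrossing C := by
  intro a b c d hs hac hbd
  obtain ⟨r₁, s₁, rfl, ha, hs₁⟩ := List.cons_sublist_iff.1 hs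
  obtain ⟨r₂, s₂, rfl, hb, hs₂⟩ := List.cons_sublist_iff.1 hs₁
  obtain ⟨r₃, s₃, rfl, hc, hs₃⟩ := List.cons_sublist_iff.1 hs₂
  obtain ⟨p₁, q₁, rfl⟩ := List.append_of_mem ha
  obtain ⟨p₂, q₂, rfl⟩ := List.append_of_mem hb
  obtain ⟨p₃, q₃, rfl⟩ := List.append_of_mem hc
  obtain ⟨p₄, q₄, rfl⟩ := List.append_of_mem (List.singleton_sublist.1 hs₃)
  have hrot : (p₁ ++ a :: q₁ ++ (p₂ ++ b :: q₂ ++ (p₃ ++ c :: q₃ ++ (p₄ ++ d :: q₄)))) ~r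
      (a :: (q₁ ++ p₂) ++ b :: (q₂ ++ p₃) ++ c :: (q₃ ++ p₄) ++ d :: (q₄ ++ p₁)) := by
    have := List.isRotated_append (l := p₁)
      (l' := a :: q₁ ++ (p₂ ++ b :: q₂ ++ (p₃ ++ c :: q₃ ++ (p₄ ++ d :: q₄))))
    simpa using this
  rw [Cycle.coe_eq_coe.2 hrot] at hCc
  have e : a :: (q₁ ++ p₂) ++ b :: (q₂ ++ p₃) ++ c :: (q₃ ++ p₄) ++ d :: (q₄ ++ p₁) =
      a :: ((q₁ ++ p₂) ++ b :: ((q₂ ++ p₃) ++ c :: (q₃ ++ p₄) ++ d :: (q₄ ++ p₁))) := by simp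
  have hn := hrot.nodup_iff.1 hC
  rw [e, cycle_chain_iff] at hCc
  have e₂ : b :: ((q₂ ++ p₃) ++ c :: (q₃ ++ p₄) ++ d :: (q₄ ++ p₁)) ++ [a] =
      (b :: (q₂ ++ p₃)) ++ c :: ((q₃ ++ p₄) ++ d :: (q₄ ++ p₁) ++ [a]) := by simp
  have e₃ : c :: ((q₃ ++ p₄) ++ d :: (q₄ ++ p₁) ++ [a]) =
      (c :: (q₃ ++ p₄)) ++ d :: ((q₄ ++ p₁) ++ [a]) := by simp
  obtain ⟨h₁, h₂⟩ := hCc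
  rw [e₂, List.isChain_split] at h₂
  obtain ⟨h₂, h₃⟩ := h₂
  rw [e₃, List.isChain_split] at h₃
  exact hX a b c d _ _ _ _ hn h₁ h₂ h₃.1 h₃.2 hac hbd

/-- A graph without the two obstructions has a noncrossing order: split it at a cut vertex, or
else follow a Hamiltonian cycle. -/
theorem exists_nonCrossing (hθ : G.ThetaFree) (hX : G.CrossingChordFree) (S : Finset V) :
    ∃ l : List V, l.Nodup ∧ (∀ v, v ∈ l ↔ v ∈ S) ∧ G.NonCrossing l := by
  classical
  induction S using Finset.strongInduction with
  | H S ih =>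
    by_cases hS : G.NoCutVertex (S : Set V)
    · by_cases h3 : 3 ≤ S.card
      · obtain ⟨C, hCS, hC, hCc⟩ := hS.exists_hamiltonian_cycle hθ h3
        exact ⟨C, hC, hCS, hX.nonCrossing hC hCc⟩
      · refine ⟨S.toList, S.nodup_toList, fun v => S.mem_toList, fun a b c d hs => ?_⟩
        have := hs.length_le
        simp at this
        omega
    · simp only [NoCutVertex, not_forall, not_exists, not_and] at hS
      obtain ⟨v, hv, A, B, ⟨a, ha⟩, ⟨b, hb⟩, hdisj, hAB, hno⟩ := hS
      have hmem : ∀ x, x ∈ A ∨ x ∈ B ↔ x ∈ S ∧ x ≠ v := fun x => Set.ext_iff.1 hAB x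
      have hdis : ∀ x ∈ A, x ∉ B := fun x hx => Set.disjoint_left.1 hdisj hx
      -- an order of the part `A` together with `v`, rotated so that `v` comes last
      have part : ∀ A B : Set V, (∀ x, x ∈ A ∨ x ∈ B ↔ x ∈ S ∧ x ≠ v) → (∀ x ∈ A, x ∉ B) →
          B.Nonempty → ∃ l : List V, (l ++ [v]).Nodup ∧ (∀ x, x ∈ l ↔ x ∈ A) ∧
            G.NonCrossing (l ++ [v]) := by
        rintro A B hmem hdis ⟨b, hb⟩
        obtain ⟨l, hl, hlS, hlX⟩ := ih (S.filter fun x => x ∈ A ∨ x = v) (by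
          refine Finset.filter_ssubset.2 ⟨b, ((hmem b).1 (Or.inr hb)).1, ?_⟩
          rintro (h | h)
          · exact hdis b h hb
          · exact ((hmem b).1 (Or.inr hb)).2 h)
        have hvl : v ∈ l := (hlS v).2 (Finset.mem_filter.2 ⟨hv, Or.inr rfl⟩)
        obtain ⟨p, q, rfl⟩ := List.append_of_mem hvl
        have hperm : (q ++ p ++ [v]).Perm (p ++ v :: q) := by
          have : p ++ v :: q = (p ++ [v]) ++ q := by simp
          rw [this, List.append_assoc]
          exact List.perm_append_comm
        have hn : (q ++ p ++ [v]).Nodup := hperm.nodup_iff.2 hl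
        refine ⟨q ++ p, hn, fun x => ?_, ?_⟩
        · have h1 : x ∈ q ++ p ++ [v] ↔ x ∈ S ∧ (x ∈ A ∨ x = v) := by
            rw [hperm.mem_iff, hlS, Finset.mem_filter]
          have h2 : v ∉ q ++ p := fun h =>
            (List.nodup_append.1 hn).2.2 v h v (by simp) rfl
          rw [List.mem_append, List.mem_singleton] at h1
          constructor
          · intro hx
            refine (h1.1 (Or.inl hx)).2.resolve_right ?_
            rintro rfl
            exact h2 hx
          · intro hx
            have h3 := (hmem x).1 (Or.inl hx)
            exact (h1.2 ⟨h3.1, Or.inl hx⟩).resolve_right h3.2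
        · rw [List.append_assoc]
          refine NonCrossing.rotate ?_
          simpa using hlX
      obtain ⟨l, hl, hlA, hlX⟩ := part A B hmem hdis ⟨b, hb⟩
      obtain ⟨l', hl', hlB, hlX'⟩ := part B A (fun x => or_comm.trans (hmem x))
        (fun x hx hx' => hdis x hx' hx) ⟨a, ha⟩
      have hvA : v ∉ l := fun h => ((hmem v).1 (Or.inl ((hlA v).1 h))).2 rfl
      have hvB : v ∉ l' := fun h => ((hmem v).1 (Or.inr ((hlB v).1 h))).2 rfl
      refine ⟨l ++ v :: l', ?_, fun x => ?_, hlX.append_cons (hlX'.rotate) hvB hvA ?_⟩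
      · refine List.nodup_append.2 ⟨(List.nodup_append.1 hl).1,
          List.nodup_cons.2 ⟨hvB, (List.nodup_append.1 hl').1⟩, ?_⟩
        rintro x hx y hy rfl
        rcases List.mem_cons.1 hy with rfl | hy
        · exact hvA hx
        · exact hdis x ((hlA x).1 hx) ((hlB x).1 hy)
      · rw [List.mem_append, List.mem_cons, hlA, hlB]
        have := hmem x
        by_cases hxv : x = v
        · subst hxv; simpa using hv
        · simp only [hxv, false_or, ne_eq, not_false_eq_true, and_true] at this ⊢
          exact this
      · intro u hu w hw
        exact hno u ((hlA u).1 hu) w ((hlB w).1 hw)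

end SimpleGraph

section ParabolaDrawings

open Set

/-! ### Drawings on a parabola -/

namespace SimpleGraph

variable {V : Type*} {G : SimpleGraph V}

/-- The point of the standard parabola over `t`. -/
def parabolaPoint (t : ℝ) : ℂ := ⟨t, t ^ 2⟩

theorem im_eq_of_mem_segment {s t : ℝ} (hst : s ≤ t) {z : ℂ}
    (hz : z ∈ segment ℝ (parabolaPoint s) (parabolaPoint t)) :
    s ≤ z.re ∧ z.re ≤ t ∧ z.im = z.re ^ 2 - (z.re - s) * (z.re - t) := by
  obtain ⟨a, b, ha, hb, hab, rfl⟩ := hz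
  obtain rfl : a = 1 - b := by linarith
  simp only [parabolaPoint, Complex.add_re, Complex.add_im, Complex.real_smul, Complex.mul_re,
    Complex.mul_im, Complex.ofReal_re, Complex.ofReal_im]
  refine ⟨?_, ?_, ?_⟩
  · nlinarith
  · nlinarith
  · ring

theorem isPlaneArc_segment {x y : ℂ} (hxy : x ≠ y) : IsPlaneArc (segment ℝ x y) x y := by
  refine ⟨Path.segment x y, fun s t hst => ?_, Path.range_segment x y⟩
  simp only [Path.segment_apply] at hst
  exact Subtype.ext (AffineMap.lineMap_injective ℝ hxy hst)

theorem exists_eq_of_mem_edgeSet {f : V → ℝ} (hf : Function.Injective f) {e : Sym2 V}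
    (he : e ∈ G.edgeSet) : ∃ u v, e = s(u, v) ∧ G.Adj u v ∧ f u < f v := by
  induction e using Sym2.ind with
  | _ u v =>
    have huv : G.Adj u v := he
    rcases lt_or_gt_of_ne (hf.ne huv.ne) with h | h
    · exact ⟨u, v, rfl, huv, h⟩
    · exact ⟨v, u, Sym2.eq_swap, huv.symm, h⟩

/-- The edge `e` is drawn as the chord of the parabola between its ends. -/
def chord (f : V → ℝ) (e : Sym2 V) : Set ℂ :=
  {z | ∃ u v, e = s(u, v) ∧ z ∈ segment ℝ (parabolaPoint (f u)) (parabolaPoint (f v))}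

theorem chord_mk (f : V → ℝ) (u v : V) :
    chord f s(u, v) = segment ℝ (parabolaPoint (f u)) (parabolaPoint (f v)) := by
  ext z
  constructor
  · rintro ⟨a, b, h, hz⟩
    rcases Sym2.eq_iff.1 h with ⟨rfl, rfl⟩ | ⟨rfl, rfl⟩
    · exact hz
    · rwa [segment_symm]
  · exact fun hz => ⟨u, v, rfl, hz⟩

/-- If no two edges cross with respect to the order given by `f`, then placing the vertices on a
parabola yields a plane drawing. -/
def parabolaDrawing {f : V → ℝ} (hf : Function.Injective f)
    (hX : ∀ a b c d, f a < f b → f b < f c → f c < f d → G.Adj a c → ¬ G.Adj b d) :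
    G.PlaneDrawing where
  pos v := parabolaPoint (f v)
  arc := chord f
  pos_injective u v huv := hf (congrArg Complex.re huv)
  isPlaneArc u v huv := by
    rw [chord_mk]
    exact isPlaneArc_segment fun h => huv.ne (hf (congrArg Complex.re h))
  vertex_mem_arc e he w hw := by
    obtain ⟨u, v, rfl, -, huv⟩ := exists_eq_of_mem_edgeSet hf he
    rw [chord_mk] at hw
    obtain ⟨-, -, h⟩ := im_eq_of_mem_segment huv.le hw
    simp only [parabolaPoint] at h
    have h' : (f w - f u) * (f w - f v) = 0 := by linarith
    rcases mul_eq_zero.1 h' with h' | h'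
    · exact Sym2.mem_iff.2 (Or.inl (hf (sub_eq_zero.1 h')))
    · exact Sym2.mem_iff.2 (Or.inr (hf (sub_eq_zero.1 h')))
  arc_inter e he e' he' hne z hz := by
    obtain ⟨a, c, rfl, hac, lac⟩ := exists_eq_of_mem_edgeSet hf he
    obtain ⟨b, d, rfl, hbd, lbd⟩ := exists_eq_of_mem_edgeSet hf he'
    rw [chord_mk, chord_mk] at hz
    obtain ⟨h₁, h₂, h₃⟩ := im_eq_of_mem_segment lac.le hz.1
    obtain ⟨k₁, k₂, k₃⟩ := im_eq_of_mem_segment lbd.le hz.2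
    have hprod : (z.re - f a) * (z.re - f c) = (z.re - f b) * (z.re - f d) := by linarith
    by_cases h0 : (z.re - f a) * (z.re - f c) = 0
    · have hv : ∃ v, v ∈ s(a, c) ∧ f v = z.re := by
        rcases mul_eq_zero.1 h0 with h | h
        · exact ⟨a, by simp, by linarith⟩
        · exact ⟨c, by simp, by linarith⟩
      have hw : ∃ v, v ∈ s(b, d) ∧ f v = z.re := by
        rcases mul_eq_zero.1 (hprod.symm.trans h0) with h | h
        · exact ⟨b, by simp, by linarith⟩
        · exact ⟨d, by simp, by linarith⟩
      obtain ⟨v, hv, hvz⟩ := hv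
      obtain ⟨w, hw, hwz⟩ := hw
      obtain rfl := hf (hvz.trans hwz.symm)
      refine ⟨v, hv, hw, Complex.ext hvz ?_⟩
      simp only [parabolaPoint]
      rw [h₃, h0, hvz, sub_zero]
    · -- the chords cross at an inner point, so their ends interleave
      exfalso
      have ha : 0 < z.re - f a := (sub_nonneg.2 h₁).lt_of_ne fun h => h0 (by rw [← h, zero_mul])
      have hc : 0 < f c - z.re := (sub_nonneg.2 h₂).lt_of_ne fun h => h0
        (mul_eq_zero.2 (Or.inr (by linarith)))
      rw [hprod] at h0
      have hb : 0 < z.re - f b := (sub_nonneg.2 k₁).lt_of_ne fun h => h0 (by rw [← h, zero_mul])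
      have hd : 0 < f d - z.re := (sub_nonneg.2 k₂).lt_of_ne fun h => h0
        (mul_eq_zero.2 (Or.inr (by linarith)))
      rcases lt_trichotomy (f a) (f b) with h | h | h
      · exact hX a b c d h (by linarith) (by nlinarith) hac hbd
      · obtain rfl := hf h
        have : f c = f d := by
          have := mul_left_cancel₀ ha.ne' hprod
          linarith
        exact hne (by rw [hf this])
      · exact hX b a d c h (by linarith) (by nlinarith) hbd hac

theorem isPreconnected_below_parabola : IsPreconnected {z : ℂ | z.im < z.re ^ 2} := by
  have : {z : ℂ | z.im < z.re ^ 2} =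
      (fun p : ℝ × ℝ => (p.1 : ℂ) + ((p.1 ^ 2 + p.2 : ℝ) : ℂ) * Complex.I) '' (univ ×ˢ Iio 0) := by
    ext z
    constructor
    · intro hz
      have hz' : z.im < z.re ^ 2 := hz
      refine ⟨(z.re, z.im - z.re ^ 2), ⟨mem_univ _, sub_neg.2 hz'⟩, ?_⟩
      apply Complex.ext <;> simp
    · rintro ⟨⟨s, t⟩, ⟨-, ht⟩, rfl⟩
      have ht' : t < 0 := ht
      simp only [mem_ofPred_eq, Complex.add_re, Complex.add_im, Complex.re_ofReal_mul,
        Complex.im_ofReal_mul, Complex.ofReal_re, Complex.ofReal_im, Complex.I_re, Complex.I_im]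
      linarith
  rw [this]
  exact (isPreconnected_univ.prod isPreconnected_Iio).image _ (by fun_prop)

theorem isOuterplanar_of_nonCrossing {f : V → ℝ} (hf : Function.Injective f)
    (hX : ∀ a b c d, f a < f b → f b < f c → f c < f d → G.Adj a c → ¬ G.Adj b d) :
    G.IsOuterplanar := by
  let D := parabolaDrawing hf hX
  have hsupp : D.support ⊆ {z | z.im < z.re ^ 2}ᶜ := by
    rintro z (⟨v, rfl⟩ | hz)
    · simp [D, parabolaDrawing, parabolaPoint]
    · obtain ⟨e, he, hze⟩ := mem_iUnion₂.1 hz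
      obtain ⟨u, v, rfl, -, huv⟩ := exists_eq_of_mem_edgeSet hf he
      have hze' : z ∈ chord f s(u, v) := hze
      rw [chord_mk] at hze'
      obtain ⟨h₁, h₂, h₃⟩ := im_eq_of_mem_segment huv.le hze'
      have := mul_nonneg (sub_nonneg.2 h₁) (sub_nonneg.2 h₂)
      simp only [mem_compl_iff, mem_ofPred_eq, not_lt]
      nlinarith
  have hsub : {z : ℂ | z.im < z.re ^ 2} ⊆ D.supportᶜ := subset_compl_comm.1 hsupp
  have hbase : (⟨0, -1⟩ : ℂ) ∈ {z : ℂ | z.im < z.re ^ 2} := by simp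
  have hF : {z : ℂ | z.im < z.re ^ 2} ⊆ connectedComponentIn D.supportᶜ ⟨0, -1⟩ :=
    isPreconnected_below_parabola.subset_connectedComponentIn hbase hsub
  refine ⟨D, connectedComponentIn D.supportᶜ ⟨0, -1⟩, ⟨⟨_, hsub hbase, rfl⟩, fun hb => ?_⟩,
    fun v => ⟨?_, fun hv => ?_⟩⟩
  · obtain ⟨r, hr, hball⟩ := hb.subset_ball_lt 0 0
    have h : (⟨0, -r⟩ : ℂ) ∈ Metric.ball (0 : ℂ) r := hball (hF (by simp [hr]))
    rw [mem_ball_zero_iff] at h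
    have h' := Complex.abs_im_le_norm ⟨0, -r⟩
    simp only [abs_neg, abs_of_pos hr] at h'
    linarith
  · refine closure_mono hF (Metric.mem_closure_iff.2 fun ε hε => ?_)
    refine ⟨⟨f v, f v ^ 2 - ε / 2⟩, by simp [hε], ?_⟩
    have : D.pos v - ⟨f v, f v ^ 2 - ε / 2⟩ = ((ε / 2 : ℝ) : ℂ) * Complex.I := by
      apply Complex.ext <;> simp [D, parabolaDrawing, parabolaPoint]
    rw [dist_eq_norm, this, norm_mul, Complex.norm_I, mul_one, Complex.norm_real,
      Real.norm_of_nonneg (by positivity)]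
    linarith
  · exact connectedComponentIn_subset _ _ (interior_subset hv) (Or.inl ⟨v, rfl⟩)

end SimpleGraph

end ParabolaDrawings

/-! ### Triangulated polygons -/

namespace SimpleGraph

/-- Adjacency of a triangulated polygon with consecutive corners `0, …, n - 1`: no two edges cross,
and each missing edge between two corners is crossed by an edge. -/
structure IsTriangulatedPolygon (A : ℕ → ℕ → Prop) (n : ℕ) : Prop where
  symm : ∀ i j, A i j → A j i
  lt : ∀ i j, A i j → i < n
  ne : ∀ i j, A i j → i ≠ j
  nonCrossing : ∀ i j k m, i < j → j < k → k < m → A i k → ¬ A j m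
  maximal : ∀ i k, i < k → k < n → ¬ A i k → ∃ j m, i < j ∧ j < k ∧ (m < i ∨ k < m) ∧ A j m

namespace IsTriangulatedPolygon

variable {A : ℕ → ℕ → Prop} {n : ℕ}

theorem adj_succ (h : IsTriangulatedPolygon A n) {i : ℕ} (hi : i + 1 < n) : A i (i + 1) := by
  by_contra hA
  obtain ⟨j, m, h₁, h₂, -⟩ := h.maximal i (i + 1) (by omega) hi hA
  omega

theorem adj_ends (h : IsTriangulatedPolygon A n) (hn : 2 ≤ n) : A 0 (n - 1) := by
  by_contra hA
  obtain ⟨j, m, h₁, h₂, h₃, hjm⟩ := h.maximal 0 (n - 1) (by omega) (by omega) hA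
  have := h.lt _ _ (h.symm _ _ hjm)
  omega

/-- The triangle on the edge `ik`: its apex is the last neighbor of `i` before `k`. -/
theorem exists_between (h : IsTriangulatedPolygon A n) {i k : ℕ} (hik : A i k) (hlt : i + 2 ≤ k) :
    ∃ j, i < j ∧ j < k ∧ A i j ∧ A j k := by
  classical
  have hkn := h.lt _ _ (h.symm _ _ hik)
  let S := (Finset.Ioo i k).filter (A i)
  have hS : S.Nonempty := ⟨i + 1, Finset.mem_filter.2
    ⟨Finset.mem_Ioo.2 (by omega), h.adj_succ (by omega)⟩⟩
  have hj := Finset.mem_filter.1 (S.max'_mem hS)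
  have hmax : ∀ m ∈ S, m ≤ S.max' hS := fun m hm => S.le_max' m hm
  generalize S.max' hS = j at hj hmax
  obtain ⟨hj, hij⟩ := hj
  rw [Finset.mem_Ioo] at hj
  refine ⟨j, hj.1, hj.2, hij, ?_⟩
  by_contra hA
  obtain ⟨b, d, h₁, h₂, h₃, hbd⟩ := h.maximal j k hj.2 hkn hA
  have hdi : d ≠ i := by
    rintro rfl
    have := hmax b (Finset.mem_filter.2 ⟨Finset.mem_Ioo.2 ⟨by omega, h₂⟩, h.symm _ _ hbd⟩)
    omega
  rcases h₃ with h₃ | h₃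
  · rcases lt_or_gt_of_ne hdi with h₄ | h₄
    · exact h.nonCrossing d i b k h₄ (by omega) h₂ (h.symm _ _ hbd) hik
    · exact h.nonCrossing i d j b h₄ h₃ h₁ hij (h.symm _ _ hbd)
  · exact h.nonCrossing i b k d (by omega) h₂ h₃ hik hbd

theorem exists_triangle (h : IsTriangulatedPolygon A n) {i k : ℕ} (hik : A i k) (hlt : i + 2 ≤ k)
    {v : ℕ} (hiv : i ≤ v) (hvk : v ≤ k) : ∃ a b, A v a ∧ A v b ∧ A a b := by
  induction hd : k - i using Nat.strong_induction_on generalizing i k with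
  | _ d ih =>
    obtain ⟨j, hij, hjk, h₁, h₂⟩ := h.exists_between hik hlt
    by_cases hvi : v = i
    · subst hvi; exact ⟨j, k, h₁, hik, h₂⟩
    by_cases hvj : v = j
    · subst hvj; exact ⟨i, k, h.symm _ _ h₁, h₂, hik⟩
    by_cases hvk' : v = k
    · subst hvk'; exact ⟨i, j, h.symm _ _ hik, h.symm _ _ h₂, h₁⟩
    rcases lt_or_gt_of_ne hvj with hlt' | hlt'
    · exact ih (j - i) (by omega) h₁ (by omega) hiv hlt'.le rfl
    · exact ih (k - j) (by omega) h₂ (by omega) hlt'.le hvk rfl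

/-- There is an ear: a corner whose only neighbors are the two next to it. -/
theorem exists_ear (h : IsTriangulatedPolygon A n) (hn : 3 ≤ n) :
    ∃ j, A j (j + 2) ∧ A j (j + 1) ∧ A (j + 1) (j + 2) ∧
      ∀ m, A (j + 1) m → m = j ∨ m = j + 2 := by
  have key : ∀ d i k, k - i = d → A i k → i + 2 ≤ k → ∃ j, A j (j + 2) := by
    intro d
    induction d using Nat.strong_induction_on with
    | _ d ih =>
      intro i k hd hik hlt
      by_cases hk : k = i + 2
      · exact ⟨i, hk ▸ hik⟩
      obtain ⟨j, hij, hjk, h₁, h₂⟩ := h.exists_between hik hlt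
      by_cases hj : i + 2 ≤ j
      · exact ih (j - i) (by omega) i j rfl h₁ hj
      · exact ih (k - j) (by omega) j k rfl h₂ (by omega)
  obtain ⟨j, hj⟩ := key _ 0 (n - 1) rfl (h.adj_ends (by omega)) (by omega)
  have hjn := h.lt _ _ (h.symm _ _ hj)
  refine ⟨j, hj, h.adj_succ (by omega), h.adj_succ (by omega), fun m hm => ?_⟩
  by_contra! hne
  have hm1 := h.ne _ _ hm
  rcases lt_or_gt_of_ne hne.1 with h₁ | h₁
  · exact h.nonCrossing m j (j + 1) (j + 2) h₁ (by omega) (by omega) (h.symm _ _ hm) hj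
  · exact h.nonCrossing j (j + 1) (j + 2) m (by omega) (by omega) (by omega) hj hm

/-- A proper coloring of the ends of an edge extends to the polygon cut off by this edge. -/
theorem exists_coloring (h : IsTriangulatedPolygon A n) {i k : ℕ} (hik : A i k) (hlt : i < k)
    {c c' : Fin 3} (hc : c ≠ c') : ∃ χ : ℕ → Fin 3, χ i = c ∧ χ k = c' ∧
      ∀ u v, i ≤ u → u < v → v ≤ k → A u v → χ u ≠ χ v := by
  induction hd : k - i using Nat.strong_induction_on generalizing i k c c' with
  | _ d ih =>
    by_cases hk : k = i + 1
    · subst hk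
      refine ⟨fun v => if v = i then c else c', by simp, by simp, fun u v hu huv hv _ => ?_⟩
      obtain rfl : u = i := by omega
      obtain rfl : v = u + 1 := by omega
      simpa using hc
    obtain ⟨j, hij, hjk, h₁, h₂⟩ := h.exists_between hik (by omega)
    obtain ⟨b, hb, hb'⟩ : ∃ b : Fin 3, c ≠ b ∧ b ≠ c' := by
      revert c c'; decide
    obtain ⟨χ, hχi, hχj, hχ⟩ := ih (j - i) (by omega) h₁ hij hb rfl
    obtain ⟨χ', hχj', hχk, hχ'⟩ := ih (k - j) (by omega) h₂ hjk hb' rfl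
    refine ⟨fun v => if v ≤ j then χ v else χ' v, by simp [hij.le, hχi],
      by simp [hjk, hχk], fun u v hu huv hv huvA => ?_⟩
    by_cases hvj : v ≤ j
    · simp only [hvj, huv.le.trans hvj, if_true]
      exact hχ u v hu huv hvj huvA
    by_cases huj : u < j
    · -- an edge across `j` crosses `ij` or `jk`, unless it is the edge `ik`
      by_cases hui : u = i
      · subst hui
        by_cases hvk : v = k
        · subst hvk
          simpa [hvj, huj.le, hχi, hχk] using hc
        · exact absurd h₂ (h.nonCrossing u j v k huj (by omega) (by omega) huvA)
      · exact absurd huvA (h.nonCrossing i u j v (by omega) huj (by omega) h₁)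
    · have hlast := hχ' u v (by omega) huv hv huvA
      by_cases huj' : u = j
      · subst huj'
        simpa [hvj, hχj, ← hχj'] using hlast
      · simpa [hvj, show ¬ u ≤ j by omega] using hlast

end IsTriangulatedPolygon

variable {V : Type*} {G : SimpleGraph V}

/-- The vertices of a maximal outerplanar graph can be numbered as the corners of a triangulated
polygon. -/
theorem IsMaximalOuterplanar.exists_isTriangulatedPolygon [Fintype V]
    (hG : G.IsMaximalOuterplanar) : ∃ e : V ≃ Fin (Fintype.card V),
      IsTriangulatedPolygon (fun i j => ∃ u v, (e u : ℕ) = i ∧ (e v : ℕ) = j ∧ G.Adj u v)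
        (Fintype.card V) := by
  classical
  obtain ⟨l, hn, hl, hX⟩ := exists_nonCrossing hG.prop.thetaFree hG.prop.crossingChordFree
    Finset.univ
  have hl' : ∀ v, v ∈ l := fun v => (hl v).2 (Finset.mem_univ v)
  let e₀ : Fin l.length ≃ V := hn.getEquivOfForallMemList l hl'
  have hcard : l.length = Fintype.card V := by simpa using Fintype.card_congr e₀
  let e : V ≃ Fin (Fintype.card V) := e₀.symm.trans (finCongr hcard)
  have hnc : ∀ a b c d, e a < e b → e b < e c → e c < e d → G.Adj a c → ¬ G.Adj b d := by
    intro a b c d hab hbc hcd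
    refine hX a b c d ?_
    have hs := List.map_getElem_sublist (l := l)
      (is := [e₀.symm a, e₀.symm b, e₀.symm c, e₀.symm d]) (by
        have hab' : e₀.symm a < e₀.symm b := hab
        have hbc' : e₀.symm b < e₀.symm c := hbc
        have hcd' : e₀.symm c < e₀.symm d := hcd
        simp only [List.pairwise_cons, List.mem_cons, List.not_mem_nil, or_false]
        grind)
    have hget : ∀ v, l[e₀.symm v] = v := fun v => e₀.apply_symm_apply v
    simpa only [List.map_cons, List.map_nil, hget] using hs
  refine ⟨e, ?_, ?_, ?_, ?_, ?_⟩
  · rintro i j ⟨u, v, hu, hv, huv⟩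
    exact ⟨v, u, hv, hu, huv.symm⟩
  · rintro i j ⟨u, v, rfl, hv, huv⟩
    exact (e u).2
  · rintro i j ⟨u, v, rfl, rfl, huv⟩ h
    exact huv.ne (e.injective (Fin.ext h))
  · rintro i j k m hij hjk hkm ⟨a, c, rfl, rfl, hac⟩ ⟨b, d, rfl, rfl, hbd⟩
    exact hnc a b c d hij hjk hkm hac hbd
  · intro i k hik hk hA
    by_contra! hcon
    let u := e.symm ⟨i, hik.trans hk⟩
    let w := e.symm ⟨k, hk⟩
    have hu : (e u : ℕ) = i := by simp [u]
    have hw : (e w : ℕ) = k := by simp [w]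
    have huw : u ≠ w := fun h => by rw [h] at hu; omega
    -- adding the missing edge keeps the order noncrossing
    have hH : (G ⊔ edge u w).IsOuterplanar := by
      refine isOuterplanar_of_nonCrossing (f := fun v => ((e v : ℕ) : ℝ))
        (fun v v' h => e.injective (Fin.ext (Nat.cast_injective h))) ?_
      intro a b c d hab hbc hcd hac hbd
      have hab' : (e a : ℕ) < e b := by exact_mod_cast hab
      have hbc' : (e b : ℕ) < e c := by exact_mod_cast hbc
      have hcd' : (e c : ℕ) < e d := by exact_mod_cast hcd
      rw [sup_adj, edge_adj] at hac hbd
      rcases hac with hac | ⟨⟨rfl, rfl⟩ | ⟨rfl, rfl⟩, -⟩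
      · rcases hbd with hbd | ⟨⟨rfl, rfl⟩ | ⟨rfl, rfl⟩, -⟩
        · exact hnc a b c d hab' hbc' hcd' hac hbd
        · exact hcon (e c) (e a) (by omega) (by omega) (Or.inl (by omega)) c a rfl rfl
            hac.symm
        · omega
      · rcases hbd with hbd | ⟨⟨rfl, rfl⟩ | ⟨rfl, rfl⟩, -⟩
        · exact hcon (e b) (e d) (by omega) (by omega) (Or.inr (by omega)) b d rfl rfl hbd
        · omega
        · omega
      · omega
    have hle := hG.le_of_ge hH le_sup_left
    exact hA ⟨u, w, hu, hw, hle (by rw [sup_adj, edge_adj]; exact Or.inr ⟨Or.inl ⟨rfl, rfl⟩, huw⟩)⟩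

end SimpleGraph

/-! ### Fall colorings of maximal outerplanar graphs -/

theorem mainTheorem3 {V : Type*} [Fintype V] (G : SimpleGraph V)
    (hG : G.IsMaximalOuterplanar) (hV : 3 ≤ Fintype.card V) :
    G.fallSet = {3} := by
  obtain ⟨e, hT⟩ := hG.exists_isTriangulatedPolygon
  have adj : ∀ u v, (∃ u' v', (e u' : ℕ) = e u ∧ (e v' : ℕ) = e v ∧ G.Adj u' v') → G.Adj u v := by
    rintro u v ⟨u', v', hu, hv, h⟩
    rwa [e.injective (Fin.ext hu), e.injective (Fin.ext hv)] at h
  apply Set.eq_singleton_iff_unique_mem.2 ⟨?_, ?_⟩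
  · -- color the polygon; each vertex lies in a triangle and thus sees both other colors
    obtain ⟨χ, -, -, hχ⟩ := hT.exists_coloring (hT.adj_ends (by omega)) (by omega)
      (zero_ne_one : (0 : Fin 3) ≠ 1)
    have hproper : ∀ u v, G.Adj u v → χ (e u) ≠ χ (e v) := by
      intro u v huv
      have hne : (e u : ℕ) ≠ e v := fun h => huv.ne (e.injective (Fin.ext h))
      have hu := (e u).2
      have hv := (e v).2
      rcases lt_or_gt_of_ne hne with h | h
      · exact hχ _ _ (by omega) h (by omega) ⟨u, v, rfl, rfl, huv⟩
      · exact (hχ _ _ (by omega) h (by omega) ⟨v, u, rfl, rfl, huv.symm⟩).symm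
    let C : G.Coloring (Fin 3) :=
      SimpleGraph.Coloring.mk (fun v => χ (e v)) fun {u v} h => hproper u v h
    have hsee : ∀ v (c : Fin 3), c ≠ C v → ∃ w, G.Adj v w ∧ C w = c := by
      intro v c hc
      obtain ⟨a, b, ⟨v₁, a₁, hv₁, ha₁, hva⟩, ⟨v₂, b₁, hv₂, hb₁, hvb⟩, ⟨a₂, b₂, ha₂, hb₂, hab⟩⟩ :=
        hT.exists_triangle (hT.adj_ends (by omega)) (by omega) (v := e v) (Nat.zero_le _)
          (by have := (e v).2; omega)
      obtain rfl := e.injective (Fin.ext hv₁)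
      obtain rfl := e.injective (Fin.ext hv₂)
      obtain rfl := e.injective (Fin.ext (ha₁.trans ha₂.symm))
      obtain rfl := e.injective (Fin.ext (hb₁.trans hb₂.symm))
      have h₁ := C.valid hva
      have h₂ := C.valid hvb
      have h₃ := C.valid hab
      have : C a₁ = c ∨ C b₁ = c := by
        revert h₁ h₂ h₃ hc
        generalize C v₂ = x
        generalize C a₁ = y
        generalize C b₁ = z
        revert c x y z
        decide
      rcases this with h | h
      · exact ⟨a₁, hva, h⟩
      · exact ⟨b₁, hvb, h⟩
    have hsurj : Function.Surjective C := by
      intro c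
      let v := e.symm ⟨0, by omega⟩
      by_cases hc : c = C v
      · exact ⟨v, hc.symm⟩
      · obtain ⟨w, -, hw⟩ := hsee v c hc
        exact ⟨w, hw⟩
    have hparts : C.toPartition.parts = Set.range C.colorClass := by
      ext s
      constructor
      · rintro ⟨v, rfl⟩
        exact ⟨C v, rfl⟩
      · rintro ⟨c, rfl⟩
        obtain ⟨v, rfl⟩ := hsurj c
        exact ⟨v, rfl⟩
    refine ⟨C.toPartition, ?_, ?_⟩
    · rw [hparts, ← Set.image_univ, Set.InjOn.encard_image]
      · simp
      · intro c _ c' _ h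
        obtain ⟨v, hv⟩ := hsurj c
        have : v ∈ C.colorClass c' := h ▸ hv
        exact hv.symm.trans this
    · rw [SimpleGraph.Partition.IsFall, hparts]
      rintro _ ⟨c, rfl⟩ v hv _ ⟨c', rfl⟩ hne
      have hv' : C v = c := hv
      obtain ⟨w, hvw, hw⟩ := hsee v c' (by rintro rfl; exact hne (by rw [hv']))
      exact ⟨w, hw, hvw⟩
  · -- the classes of an ear and of its two neighbors are distinct, and there are no others
    rintro k ⟨P, hk, hP⟩
    obtain ⟨j, ⟨a, b, ha, hb, hab⟩, ⟨a', v, ha', hv, hav⟩, ⟨v', b', hv', hb', hvb⟩, hear⟩ :=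
      hT.exists_ear hV
    obtain rfl := e.injective (Fin.ext (ha'.trans ha.symm))
    obtain rfl := e.injective (Fin.ext (hb'.trans hb.symm))
    obtain rfl := e.injective (Fin.ext (hv'.trans hv.symm))
    have hnb : ∀ w, G.Adj v' w → w = a' ∨ w = b' := by
      intro w hw
      rcases hear (e w) ⟨v', w, hv, rfl, hw⟩ with h | h
      · exact Or.inl (e.injective (Fin.ext (h.trans ha.symm)))
      · exact Or.inr (e.injective (Fin.ext (h.trans hb.symm)))
    have hparts : P.parts = {P.partOfVertex v', P.partOfVertex a', P.partOfVertex b'} := by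
      ext B
      simp only [Set.mem_insert_iff, Set.mem_singleton_iff]
      constructor
      · intro hB
        by_cases hBv : B = P.partOfVertex v'
        · exact Or.inl hBv
        obtain ⟨w, hw, hvw⟩ := hP _ (P.partOfVertex_mem v') v' (P.mem_partOfVertex v') B hB hBv
        have huniq : B = P.partOfVertex w := (P.isPartition.2 w).unique ⟨hB, hw⟩
          ⟨P.partOfVertex_mem w, P.mem_partOfVertex w⟩
        rcases hnb w hvw with rfl | rfl
        · exact Or.inr (Or.inl huniq)
        · exact Or.inr (Or.inr huniq)
      · rintro (rfl | rfl | rfl) <;> exact P.partOfVertex_mem _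
    have h3 : P.parts.encard = 3 := by
      rw [hparts, Set.encard_eq_three]
      exact ⟨_, _, _, (P.partOfVertex_ne_of_adj hav).symm, P.partOfVertex_ne_of_adj hvb,
        P.partOfVertex_ne_of_adj hab, rfl⟩
    have hk3 : (k : ℕ∞) = 3 := hk.symm.trans h3
    exact_mod_cast hk3
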